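/- Let $p$ be a prime, let $D>1$ be a product of an even number of distinct primes, and let $M\ge 1$ be an integer with $\gcd(D,M)=1$ and $p\nmid DM$. Let $B$ be the quaternion algebra over $\mathbb Q$ of discriminant $D$, and for every prime $\ell\mid pM$ fix an isomorphism $\iota_\ell\colon B\otimes\mathbb Q_\ell\simeq M_2(\mathbb Q_\ell)$. Let $R_0(pM)\subseteq R_0(M)$ be Eichler orders of $B$ of levels $pM$ and $M$ such that, for every prime $\ell\mid pM$ and for $N=pM$, respectively $N=M$, $$\iota_\ell(R_0(N)\otimes\mathbb Z_\ell)=\{\left(\begin{smallmatrix}a&b\\c&d\end{smallmatrix}\right)\in M_2(\mathbb Z_\ell): c\in N\mathbb Z_\ell\}.$$ Write $\Gamma_0^D(M)$, $\Gamma_0^D(pM)$ and $\Gamma$ for the groups of units of reduced norm $1$ of $R_0(M)$, $R_0(pM)$ and $R_0(M)\otimes\mathbb Z[1/p]$, and $\Gamma_0^{\rm loc}(p)=\{\left(\begin{smallmatrix}a&b\\c&d\end{smallmatrix}\right)\in SL_2(\mathbb Z_p): c\in p\mathbb Z_p\}$. Let $\mathcal T$ be the Bruhat–Tits tree of $PGL_2(\mathbb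 Q_p)$, with $d$ its distance: its vertices are the homothety classes of $\mathbb Z_p$-lattices in $\mathbb Q_p^2$, and its directed edges are the pairs $e=(s(e),t(e))$ of vertices represented by lattices $\Lambda_1,\Lambda_2$ with $p\Lambda_1\subsetneq\Lambda_2\subsetneq\Lambda_1$. Then $B^\times$ acts on $\mathcal T$ through $\iota_p$. Let $v_*$ and $\hat v_*$ be the classes of $\mathbb Z_p\oplus\mathbb Z_p$ and $\mathbb Z_p\oplus p\mathbb Z_p$, and $e_*=(v_*,\hat v_*)$. A vertex $v$ is even or odd according to the parity of $d(v,v_*)$, and an edge is even if its source is. Let $\mathcal E^+$ be the set of even edges and $\mathcal V$ the set of vertices. Fix a system of representatives $\gamma_0=1,\gamma_1,\dots,\gamma_p$ of $\Gamma_0^D(pM)\backslash\Gamma_0^D(M)$ with $\iota_p(\gamma_i)\in\Gamma_0^{\rm loc}(p)\left(\begin{smallmatrix}0&-1\\1&i\end{smallmatrix}\right)$ for $i>0$, and an element $\omega_p\in R_0(pM)\cap B^\times$ that normalizes $\Gamma_0^D(pM)$ and satisfies $\iota_p(\omega_p)\in\Gamma_0^{\rm loc}(p)\left(\begin{smallmatrix}0&-1\\p&0\end{smallmatrix}\right)$.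 Put $\tilde\gamma_0=1$ and $\tilde\gamma_i=p^{-1}\omega_p\gamma_i\omega_p$ for $i>0$. Then there are unique families $(\gamma_e)_{e\in\mathcal E^+}$ and $(\gamma_v)_{v\in\mathcal V}$ in $\Gamma$ (the radial system) such that: $\gamma_e^{-1}(e_*)=e$ for all $e\in\mathcal E^+$ and $\gamma_v^{-1}(v_*)=v$ for all even $v$; $\gamma_{v_*}=\gamma_{\hat v_*}=1$; $\{\gamma_e\}_{e\in\mathcal E^+,\,s(e)=v}=\{\gamma_i\gamma_v\}_{i=0}^p$ for even $v$; $\{\gamma_e\}_{e\in\mathcal E^+,\,t(e)=v}=\{\tilde\gamma_i\gamma_v\}_{i=0}^p$ for odd $v$; and, for $e\in\mathcal E^+$, $\gamma_{s(e)}=\gamma_e$ if $d(t(e),v_*)<d(s(e),v_*)$ and $\gamma_{t(e)}=\gamma_e$ if $d(t(e),v_*)>d(s(e),v_*)$. Moreover, there is an algorithm that, given $g\in\Gamma$, outputs $h(g)\in\Gamma_0^D(pM)$ and $\gamma_e$ with $g=h(g)\gamma_e$, where $e=g^{-1}(e_*)\in\mathcal E^+$, in time proportional to the distance from $e_*$ to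 $e$. Precisely: there are a constant $C$ and a program which works on registers that hold elements of $B$, whose elementary steps are the assignments of a constant, of the contents of a register, or of the sum or product of the contents of two registers, and the tests whether the contents of a register lie in $R_0(M)$ or in $R_0(pM)$ (used for branches and loops), such that for every $g\in\Gamma$ the program halts with this output after $t$ steps, where, with $d(e_*,e)=d(v_*,s(e))$, $$d(e_*,e)\le C\,t\qquad\text{and}\qquad t\le C\,(d(e_*,e)+1).$$ -/

import Mathlib

open scoped TensorProduct Matrix Quaternion

noncomputable section

/-! ### Quaternion algebras over `ℚ`, orders, and norm one units -/

/-- The quaternion algebra `(a, b / ℚ)`, with basis `1, i, j, ij`, `i² = a`, `j² = b`, `ij = -ji`. -/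
abbrev QAlg (a b : ℚ) : Type := QuaternionAlgebra ℚ a 0 b

/-- The reduced norm of `(a, b / ℚ)`. -/
def nrd {a b : ℚ} (x : QAlg a b) : ℚ :=
  x.re ^ 2 - a * x.imI ^ 2 - b * x.imJ ^ 2 + a * b * x.imK ^ 2

theorem nrd_mul {a b : ℚ} (x y : QAlg a b) : nrd (x * y) = nrd x * nrd y := by
  simp only [nrd, QuaternionAlgebra.re_mul, QuaternionAlgebra.imI_mul,
    QuaternionAlgebra.imJ_mul, QuaternionAlgebra.imK_mul]
  ring

theorem nrd_one {a b : ℚ} : nrd (1 : QAlg a b) = 1 := by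
  simp [nrd]

/-- The usual description of the reduced norm: `x * x̄ = nrd x`. -/
theorem mul_star_eq_nrd {a b : ℚ} (x : QAlg a b) :
    x * star x = algebraMap ℚ (QAlg a b) (nrd x) := by
  ext <;> simp [nrd, QuaternionAlgebra.algebraMap_eq] <;> ring

/-- Isomorphisms `B ⊗ ℚ_ℓ ≃ M₂(ℚ_ℓ)`, for `B = (a, b / ℚ)`. -/
abbrev Splitting (a b : ℚ) (ℓ : ℕ) [Fact ℓ.Prime] : Type :=
  (ℚ_[ℓ] ⊗[ℚ] QAlg a b) ≃ₐ[ℚ_[ℓ]] Matrix (Fin 2) (Fin 2) ℚ_[ℓ]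

/-- `(a, b / ℚ)` has discriminant `D`: `D` is the product of the primes at which the algebra
is ramified (that is, does not split). -/
def HasDiscriminant (a b : ℚ) (D : ℕ) : Prop :=
  Squarefree D ∧ ∀ (ℓ : ℕ) [Fact ℓ.Prime], ℓ ∣ D ↔ IsEmpty (Splitting a b ℓ)

/-- The restriction of a splitting to the quaternion algebra itself. -/
def Splitting.toHom {a b : ℚ} {ℓ : ℕ} [Fact ℓ.Prime] (f : Splitting a b ℓ) :
    QAlg a b →* Matrix (Fin 2) (Fin 2) ℚ_[ℓ] :=
  (f : (ℚ_[ℓ] ⊗[ℚ] QAlg a b) →* Matrix (Fin 2) (Fin 2) ℚ_[ℓ]).comp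
    ((Algebra.TensorProduct.includeRight : QAlg a b →ₐ[ℚ] ℚ_[ℓ] ⊗[ℚ] QAlg a b) :
      QAlg a b →* ℚ_[ℓ] ⊗[ℚ] QAlg a b)

theorem Splitting.toHom_apply {a b : ℚ} {ℓ : ℕ} [Fact ℓ.Prime] (f : Splitting a b ℓ)
    (x : QAlg a b) : f.toHom x = f (1 ⊗ₜ x) := rfl

/-- An order: a subring that is a full `ℤ`-lattice. -/
def IsOrder {a b : ℚ} (R : Subring (QAlg a b)) : Prop :=
  (AddSubgroup.toIntSubmodule R.toAddSubgroup).FG ∧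
    Submodule.span ℚ (R : Set (QAlg a b)) = ⊤

/-- The local Eichler order `{(a b; c d) ∈ M₂(ℤ_ℓ) : c ≡ 0 mod N ℤ_ℓ}`. It is `M₂(ℤ_ℓ)` if `ℓ ∤ N`. -/
def localEichler (ℓ N : ℕ) [Fact ℓ.Prime] : Set (Matrix (Fin 2) (Fin 2) ℚ_[ℓ]) :=
  {A | (∀ i j, ‖A i j‖ ≤ 1) ∧ ‖A 1 0‖ ≤ ‖(N : ℚ_[ℓ])‖}

/-- `f (R ⊗ ℤ_ℓ) ⊆ M₂(ℚ_ℓ)`. -/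
def localCompletion {a b : ℚ} {ℓ : ℕ} [Fact ℓ.Prime] (f : Splitting a b ℓ)
    (R : Subring (QAlg a b)) : Submodule ℤ_[ℓ] (Matrix (Fin 2) (Fin 2) ℚ_[ℓ]) :=
  Submodule.span ℤ_[ℓ] (f.toHom '' (R : Set (QAlg a b)))

/-- `R` is an Eichler order of level `N` which is put in standard form, at the primes
dividing `n`, by the splittings `ι`; here `N` divides a power of `n`.
That `R ⊗ ℤ_ℓ` is a maximal order for `ℓ ∤ N` is expressed by saying that no
order containing `R` has index divisible by `ℓ`. -/
structure IsEichlerOrder {a b : ℚ} {n : ℕ}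
    (ι : ∀ (ℓ : ℕ) [Fact ℓ.Prime], ℓ ∣ n → Splitting a b ℓ) (N : ℕ)
    (R : Subring (QAlg a b)) : Prop where
  isOrder : IsOrder R
  maximal_away : ∀ O : Subring (QAlg a b), IsOrder O → R ≤ O → ∀ ℓ : ℕ, ℓ.Prime →
    ℓ ∣ R.toAddSubgroup.relIndex O.toAddSubgroup → ℓ ∣ N
  local_form : ∀ (ℓ : ℕ) [Fact ℓ.Prime] (h : ℓ ∣ n),
    (localCompletion (ι ℓ h) R : Set (Matrix (Fin 2) (Fin 2) ℚ_[ℓ])) = localEichler ℓ N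

/-- `R ⊗ ℤ[1/p]`, as a subring of the quaternion algebra. -/
def invertP {a b : ℚ} (p : ℕ) (R : Subring (QAlg a b)) : Subring (QAlg a b) where
  carrier := {x | ∃ k : ℕ, (p : QAlg a b) ^ k * x ∈ R}
  one_mem' := ⟨0, by simp⟩
  zero_mem' := ⟨0, by simp⟩
  neg_mem' := by
    rintro x ⟨k, hk⟩
    exact ⟨k, by simpa using R.neg_mem hk⟩
  mul_mem' := by
    rintro x y ⟨k, hk⟩ ⟨m, hm⟩
    refine ⟨k + m, ?_⟩
    have h : (p : QAlg a b) ^ (k + m) * (x * y) = ((p : QAlg a b) ^ k * x) * ((p : QAlg a b) ^ m * y) := by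
      have hc : (p : QAlg a b) ^ m * x = x * (p : QAlg a b) ^ m :=
        ((Nat.cast_commute p x).pow_left m)
      rw [pow_add]
      simp only [mul_assoc]
      rw [← mul_assoc _ x y, hc, mul_assoc]
    rw [h]
    exact R.mul_mem hk hm
  add_mem' := by
    rintro x y ⟨k, hk⟩ ⟨m, hm⟩
    refine ⟨k + m, ?_⟩
    have h : (p : QAlg a b) ^ (k + m) * (x + y) =
        (p : QAlg a b) ^ m * ((p : QAlg a b) ^ k * x) +
          (p : QAlg a b) ^ k * ((p : QAlg a b) ^ m * y) := by
      rw [mul_add, ← mul_assoc, ← mul_assoc, ← pow_add, ← pow_add, add_comm m k]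
    rw [h]
    have hp : ∀ j : ℕ, (p : QAlg a b) ^ j ∈ R := fun j => R.pow_mem (natCast_mem R p) j
    exact R.add_mem (R.mul_mem (hp m) hk) (R.mul_mem (hp k) hm)

/-- The group `R₁ˣ` of units of `R` of reduced norm one. -/
def normOneUnits {a b : ℚ} (R : Subring (QAlg a b)) : Subgroup (QAlg a b)ˣ where
  carrier := {u | (u : QAlg a b) ∈ R ∧ ((u⁻¹ : (QAlg a b)ˣ) : QAlg a b) ∈ R ∧
    nrd (u : QAlg a b) = 1}
  one_mem' := ⟨by simp, by simp, by simpa using nrd_one⟩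
  mul_mem' := by
    rintro u v ⟨hu, hu', hn⟩ ⟨hv, hv', hm⟩
    refine ⟨by simpa using R.mul_mem hu hv, by simpa using R.mul_mem hv' hu', ?_⟩
    rw [Units.val_mul, nrd_mul, hn, hm, one_mul]
  inv_mem' := by
    rintro u ⟨hu, hu', hn⟩
    refine ⟨hu', by simpa using hu, ?_⟩
    have h : nrd ((u : QAlg a b) * ((u⁻¹ : (QAlg a b)ˣ) : QAlg a b)) = 1 := by
      rw [Units.mul_inv, nrd_one]
    rwa [nrd_mul, hn, one_mul] at h

/-- `Γ₀^loc(p) = {(a b; c d) ∈ SL₂(ℤ_p) : c ≡ 0 mod p}`. -/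
def localGamma0 (p : ℕ) [Fact p.Prime] : Set (Matrix (Fin 2) (Fin 2) ℚ_[p]) :=
  {A | A ∈ localEichler p p ∧ A.det = 1}

/-! ### The Bruhat–Tits tree of `PGL₂(ℚ_p)` -/

section Tree

variable (p : ℕ) [Fact p.Prime]

/-- `ℤ_p`-lattices in `ℚ_p²`. -/
@[ext]
structure PLattice where
  /-- the underlying submodule -/
  carrier : Submodule ℤ_[p] (Fin 2 → ℚ_[p])
  fg : carrier.FG
  span_eq_top : Submodule.span ℚ_[p] (carrier : Set (Fin 2 → ℚ_[p])) = ⊤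

variable {p}

/-- The action of a matrix on column vectors, as a `ℤ_p`-linear map. -/
def matAct (A : Matrix (Fin 2) (Fin 2) ℚ_[p]) : (Fin 2 → ℚ_[p]) →ₗ[ℤ_[p]] (Fin 2 → ℚ_[p]) :=
  A.mulVecLin.restrictScalars ℤ_[p]

theorem matAct_mul (A B : Matrix (Fin 2) (Fin 2) ℚ_[p]) :
    matAct (A * B) = (matAct A).comp (matAct B) := by
  ext1 x
  simp [matAct]

theorem matAct_one : matAct (1 : Matrix (Fin 2) (Fin 2) ℚ_[p]) = LinearMap.id := by
  ext1 x
  simp [matAct]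

/-- The lattice `g Λ`. -/
def PLattice.act (g : GL (Fin 2) ℚ_[p]) (L : PLattice p) : PLattice p :=
  ⟨L.carrier.map (matAct g.1), L.fg.map _, by
    have h : ((L.carrier.map (matAct g.1) : Submodule ℤ_[p] (Fin 2 → ℚ_[p])) : Set (Fin 2 → ℚ_[p])) =
        g.1.mulVecLin '' (L.carrier : Set (Fin 2 → ℚ_[p])) := rfl
    rw [h, Submodule.span_image, L.span_eq_top, Submodule.map_top, LinearMap.range_eq_top]
    intro y
    refine ⟨(g⁻¹).1 *ᵥ y, ?_⟩
    rw [Matrix.mulVecLin_apply, Matrix.mulVec_mulVec, ← Units.val_mul, mul_inv_cancel,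
      Units.val_one, Matrix.one_mulVec]⟩

instance : MulAction (GL (Fin 2) ℚ_[p]) (PLattice p) where
  smul := PLattice.act
  one_smul L := PLattice.ext (by
    change L.carrier.map (matAct 1) = L.carrier
    rw [matAct_one, Submodule.map_id])
  mul_smul g h L := PLattice.ext (by
    change L.carrier.map (matAct (g.1 * h.1)) = (L.carrier.map (matAct h.1)).map (matAct g.1)
    rw [matAct_mul, Submodule.map_comp])

/-- The scalar matrix `c`. -/
def scalarGL (c : ℚ_[p]ˣ) : GL (Fin 2) ℚ_[p] :=
  Units.map (algebraMap ℚ_[p] (Matrix (Fin 2) (Fin 2) ℚ_[p])).toMonoidHom c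

theorem scalarGL_comm (c : ℚ_[p]ˣ) (g : GL (Fin 2) ℚ_[p]) : scalarGL c * g = g * scalarGL c :=
  Units.ext (Algebra.commutes (c : ℚ_[p]) g.1)

variable (p) in
/-- Two lattices are homothetic if one is a scalar multiple of the other. -/
def homothety : Setoid (PLattice p) where
  r L L' := ∃ c : ℚ_[p]ˣ, L' = scalarGL c • L
  iseqv :=
    { refl := fun L => ⟨1, by simp [scalarGL]⟩
      symm := by
        rintro L L' ⟨c, rfl⟩
        exact ⟨c⁻¹, by simp [scalarGL]⟩
      trans := by
        rintro L L' L'' ⟨c, rfl⟩ ⟨d, rfl⟩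
        exact ⟨d * c, by simp [scalarGL, mul_smul]⟩ }

variable (p) in
/-- Vertices of the Bruhat–Tits tree: homothety classes of lattices. -/
def Vertex : Type := Quotient (homothety p)

/-- The vertex represented by a lattice. -/
def PLattice.toVertex (L : PLattice p) : Vertex p := Quotient.mk (homothety p) L

instance : MulAction (GL (Fin 2) ℚ_[p]) (Vertex p) where
  smul g := Quotient.map (fun L => g • L) (by
    rintro L L' ⟨c, rfl⟩
    exact ⟨c, by rw [← mul_smul, ← mul_smul, scalarGL_comm]⟩)
  one_smul v := by
    induction v using Quotient.inductionOn with
    | h L => exact congrArg (Quotient.mk (homothety p)) (one_smul _ L)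
  mul_smul g h v := by
    induction v using Quotient.inductionOn with
    | h L => exact congrArg (Quotient.mk (homothety p)) (mul_smul g h L)

theorem smul_toVertex (g : GL (Fin 2) ℚ_[p]) (L : PLattice p) :
    g • L.toVertex = (g • L).toVertex := rfl

variable (p) in
/-- The scalar matrix `p`. -/
def scalarP : GL (Fin 2) ℚ_[p] :=
  scalarGL (Units.mk0 (p : ℚ_[p]) (Nat.cast_ne_zero.mpr (Fact.out : p.Prime).ne_zero))

/-- `v₁` and `v₂` can be represented by lattices with `p Λ₁ ⊊ Λ₂ ⊊ Λ₁`. -/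
def Neighbor (v₁ v₂ : Vertex p) : Prop :=
  ∃ L₁ L₂ : PLattice p, L₁.toVertex = v₁ ∧ L₂.toVertex = v₂ ∧
    (scalarP p • L₁).carrier < L₂.carrier ∧ L₂.carrier < L₁.carrier

theorem smul_carrier_lt (g : GL (Fin 2) ℚ_[p]) {L₁ L₂ : PLattice p}
    (h : L₁.carrier < L₂.carrier) : (g • L₁).carrier < (g • L₂).carrier := by
  have key : ∀ (g : GL (Fin 2) ℚ_[p]) {L₁ L₂ : PLattice p}, L₁.carrier ≤ L₂.carrier →
      (g • L₁).carrier ≤ (g • L₂).carrier := fun g _ _ h => Submodule.map_mono h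
  refine lt_of_le_not_ge (key g h.le) fun h' => h.not_ge ?_
  have := key g⁻¹ h'
  rwa [inv_smul_smul, inv_smul_smul] at this

theorem Neighbor.smul {v₁ v₂ : Vertex p} (h : Neighbor v₁ v₂) (g : GL (Fin 2) ℚ_[p]) :
    Neighbor (g • v₁) (g • v₂) := by
  obtain ⟨L₁, L₂, rfl, rfl, h₁, h₂⟩ := h
  refine ⟨g • L₁, g • L₂, rfl, rfl, ?_, smul_carrier_lt g h₂⟩
  have e : scalarP p • g • L₁ = g • scalarP p • L₁ := by
    rw [← mul_smul, ← mul_smul, scalarP, scalarGL_comm]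
  rw [e]
  exact smul_carrier_lt g h₁

variable (p) in
/-- The Bruhat–Tits tree, as a graph. The relation `Neighbor` is in fact irreflexive and
symmetric, so that adjacency is `Neighbor`. -/
def bruhatTits : SimpleGraph (Vertex p) := SimpleGraph.fromRel Neighbor

variable (p) in
/-- Directed edges of the tree. -/
@[ext]
structure Edge where
  /-- the source -/
  src : Vertex p
  /-- the target -/
  tgt : Vertex p
  neighbor : Neighbor src tgt

instance : MulAction (GL (Fin 2) ℚ_[p]) (Edge p) where
  smul g e := ⟨g • e.src, g • e.tgt, e.neighbor.smul g⟩
  one_smul e := Edge.ext (one_smul _ e.src) (one_smul _ e.tgt)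
  mul_smul g h e := Edge.ext (mul_smul g h e.src) (mul_smul g h e.tgt)

/-- The lattice `ℤ_p ⊕ c ℤ_p`, for `c ≠ 0`. -/
def diagLattice (c : ℚ_[p]) (hc : c ≠ 0) : PLattice p :=
  ⟨Submodule.span ℤ_[p] {![1, 0], ![0, c]}, Submodule.fg_span (Set.toFinite _), by
    rw [Submodule.span_span_of_tower, eq_top_iff]
    intro x _
    rw [Submodule.mem_span_pair]
    refine ⟨x 0, x 1 / c, ?_⟩
    ext i
    fin_cases i <;> simp [hc]⟩

variable (p) in
/-- `v_*`, represented by `ℤ_p ⊕ ℤ_p`. -/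
def vStar : Vertex p := (diagLattice (1 : ℚ_[p]) one_ne_zero).toVertex

variable (p) in
/-- `v̂_*`, represented by `ℤ_p ⊕ p ℤ_p`. -/
def vHat : Vertex p :=
  (diagLattice (p : ℚ_[p]) (Nat.cast_ne_zero.mpr (Fact.out : p.Prime).ne_zero)).toVertex

theorem neighbor_vStar_vHat : Neighbor (vStar p) (vHat p) := by
  have hp0 : (p : ℚ_[p]) ≠ 0 := Nat.cast_ne_zero.mpr (Fact.out : p.Prime).ne_zero
  have hmem : ∀ (c : ℚ_[p]) (hc : c ≠ 0) (x : Fin 2 → ℚ_[p]),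
      x ∈ (diagLattice c hc).carrier ↔ ∃ r s : ℤ_[p], x 0 = r ∧ x 1 = s * c := by
    intro c hc x
    change x ∈ Submodule.span ℤ_[p] {![1, 0], ![0, c]} ↔ _
    rw [Submodule.mem_span_pair]
    constructor
    · rintro ⟨r, s, rfl⟩
      exact ⟨r, s, by simp [Algebra.smul_def], by simp [Algebra.smul_def]⟩
    · rintro ⟨r, s, hr, hs⟩
      refine ⟨r, s, ?_⟩
      ext i
      fin_cases i <;> simp [Algebra.smul_def, hr, hs]
  have hscal : ∀ x : Fin 2 → ℚ_[p], x ∈ (scalarP p • diagLattice (1 : ℚ_[p]) one_ne_zero).carrier ↔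
      ∃ y ∈ (diagLattice (1 : ℚ_[p]) one_ne_zero).carrier, (p : ℚ_[p]) • y = x := by
    intro x
    change x ∈ Submodule.map (matAct (algebraMap ℚ_[p] _ (p : ℚ_[p]))) _ ↔ _
    rw [Submodule.mem_map]
    have : ∀ y, matAct (algebraMap ℚ_[p] (Matrix (Fin 2) (Fin 2) ℚ_[p]) (p : ℚ_[p])) y =
        (p : ℚ_[p]) • y := by
      intro y
      simp [matAct]
    simp only [this]
  have hnot : ∀ s : ℤ_[p], (1 : ℚ_[p]) ≠ p * s := by
    intro s h
    have h1 : ‖(1 : ℚ_[p])‖ = ‖(p : ℚ_[p])‖ * ‖s‖ := by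
      rw [h, norm_mul]; rfl
    rw [norm_one] at h1
    have h2 : ‖(p : ℚ_[p])‖ < 1 := Padic.norm_p_lt_one
    have h3 := s.norm_le_one
    nlinarith [norm_nonneg (p : ℚ_[p]), norm_nonneg s]
  refine ⟨_, _, rfl, rfl, ?_, ?_⟩
  · refine lt_of_le_not_ge ?_ ?_
    · intro x hx
      obtain ⟨y, hy, rfl⟩ := (hscal x).1 hx
      obtain ⟨r, s, hr, hs⟩ := (hmem _ _ _).1 hy
      exact (hmem _ _ _).2 ⟨p * r, s, by simp [hr], by simp [hs, mul_comm]⟩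
    · intro h
      obtain ⟨y, hy, h1⟩ := (hscal _).1 (h ((hmem _ _ ![1, 0]).2 ⟨1, 0, by simp, by simp⟩))
      obtain ⟨r, s, hr, hs⟩ := (hmem _ _ _).1 hy
      have := congrFun h1 0
      simp [hr] at this
      exact hnot r this.symm
  · refine lt_of_le_not_ge ?_ ?_
    · intro x hx
      obtain ⟨r, s, hr, hs⟩ := (hmem _ _ _).1 hx
      exact (hmem _ _ _).2 ⟨r, s * p, hr, by simp [hs]⟩
    · intro h
      obtain ⟨r, s, hr, hs⟩ := (hmem _ _ _).1 (h ((hmem _ _ ![0, 1]).2 ⟨0, 1, by simp, by simp⟩))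
      simp at hs
      exact hnot s (by rw [mul_comm]; exact hs)

variable (p) in
/-- The edge `e_* = (v_*, v̂_*)`. -/
def eStar : Edge p := ⟨vStar p, vHat p, neighbor_vStar_vHat⟩

/-- The distance to `v_*` in the tree. -/
def depth (v : Vertex p) : ℕ := (bruhatTits p).dist v (vStar p)

variable (p) in
/-- Even edges: those whose source has even distance to `v_*`. -/
def EvenEdge : Type := {e : Edge p // Even (depth e.src)}

/-- The distance from `e_*` to `e`, measured between the sources. -/
def edgeDist (e : Edge p) : ℕ := (bruhatTits p).dist (eStar p).src e.src

end Tree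

/-- The homomorphism `Bˣ → GL₂(ℚ_p)` given by a splitting at `p`; through it, `Bˣ` acts
on the tree. -/
def Splitting.toGL {a b : ℚ} {p : ℕ} [Fact p.Prime] (f : Splitting a b p) :
    (QAlg a b)ˣ →* GL (Fin 2) ℚ_[p] :=
  Units.map f.toHom

/-! ### The fixed representatives and the radial system -/

/-- `Υ = {γ₀, …, γ_p}` is a system of representatives of `Γ₀(pM) \ Γ₀(M)` with `γ₀ = 1` and
`ι_p(γ_i) = u_i (0 -1; 1 i)`, `u_i ∈ Γ₀^loc(p)`, for `i > 0`. -/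
structure IsUpsilon {a b : ℚ} {p : ℕ} [Fact p.Prime] (f : Splitting a b p)
    (G₀M G₀pM : Subgroup (QAlg a b)ˣ) (γ : Fin (p + 1) → (QAlg a b)ˣ) : Prop where
  mem : ∀ i, γ i ∈ G₀M
  representatives : ∀ g ∈ G₀M, ∃! i, g * (γ i)⁻¹ ∈ G₀pM
  zero : γ 0 = 1
  local_form : ∀ i, i ≠ 0 → ∃ u ∈ localGamma0 p,
    f.toHom (γ i : QAlg a b) = u * !![0, -1; 1, ((i : ℕ) : ℚ_[p])]

/-- `ω_p` is an element of `R₀(pM)` that normalizes `Γ₀(pM)` and satisfies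
`ι_p(ω_p) = u' (0 -1; p 0)` with `u' ∈ Γ₀^loc(p)`. -/
structure IsAtkinLehner {a b : ℚ} {p : ℕ} [Fact p.Prime] (f : Splitting a b p)
    (R₀pM : Subring (QAlg a b)) (ω : (QAlg a b)ˣ) : Prop where
  mem : (ω : QAlg a b) ∈ R₀pM
  normalizes : ω ∈ Subgroup.normalizer (normOneUnits R₀pM : Set (QAlg a b)ˣ)
  local_form : ∃ u ∈ localGamma0 p, f.toHom (ω : QAlg a b) = u * !![0, -1; (p : ℚ_[p]), 0]

/-- The scalar `p`, as a unit of the quaternion algebra. -/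
def unitP (a b : ℚ) (p : ℕ) [Fact p.Prime] : (QAlg a b)ˣ :=
  Units.map (algebraMap ℚ (QAlg a b)).toMonoidHom
    (Units.mk0 (p : ℚ) (Nat.cast_ne_zero.mpr (Fact.out : p.Prime).ne_zero))

/-- `γ̃₀ = 1` and `γ̃_i = p⁻¹ ω_p γ_i ω_p` for `i > 0`. -/
def tildeGamma {a b : ℚ} {p : ℕ} [Fact p.Prime] (γ : Fin (p + 1) → (QAlg a b)ˣ)
    (ω : (QAlg a b)ˣ) (i : Fin (p + 1)) : (QAlg a b)ˣ :=
  if i = 0 then 1 else (unitP a b p)⁻¹ * ω * γ i * ω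

/-- The families `γ_e` (`e` an even edge) and `γ_v` (`v` a vertex) form the radial system attached
to `γ_i` and `γ̃_i`. The fields `edge_rep` and `vertex_rep` say that `γ_e` and `γ_v` (`v` even)
represent the cosets that correspond to `e` and `v` under `g ↦ g⁻¹(e_*)` and `g ↦ g⁻¹(v_*)`. -/
structure IsRadialSystem {a b : ℚ} {p : ℕ} [Fact p.Prime] (f : Splitting a b p)
    (Γ : Subgroup (QAlg a b)ˣ) (γ γt : Fin (p + 1) → (QAlg a b)ˣ)
    (γE : EvenEdge p → (QAlg a b)ˣ) (γV : Vertex p → (QAlg a b)ˣ) : Prop where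
  edge_mem : ∀ e, γE e ∈ Γ
  vertex_mem : ∀ v, γV v ∈ Γ
  edge_rep : ∀ e : EvenEdge p, (f.toGL (γE e))⁻¹ • eStar p = e.1
  vertex_rep : ∀ v, Even (depth v) → (f.toGL (γV v))⁻¹ • vStar p = v
  vStar_eq : γV (vStar p) = 1
  vHat_eq : γV (vHat p) = 1
  outgoing : ∀ v, Even (depth v) →
    γE '' {e | e.1.src = v} = Set.range fun i => γ i * γV v
  incoming : ∀ v, Odd (depth v) →
    γE '' {e | e.1.tgt = v} = Set.range fun i => γt i * γV v
  src_eq : ∀ e : EvenEdge p, depth e.1.tgt < depth e.1.src → γV e.1.src = γE e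
  tgt_eq : ∀ e : EvenEdge p, depth e.1.src < depth e.1.tgt → γV e.1.tgt = γE e

/-! ### Algorithms and running time -/

/-- Programs over a ring `A`, acting on registers `x₀, x₁, …` which hold elements of `A`. Besides
ring operations they may test whether a register lies in one of the sets `T i`, `i : τ`. -/
inductive Prog (A τ : Type) : Type
  /-- `x := c` -/
  | const (x : ℕ) (c : A)
  /-- `x := y` -/
  | copy (x y : ℕ)
  /-- `x := y + z` -/
  | add (x y z : ℕ)
  /-- `x := y * z` -/
  | mul (x y z : ℕ)
  /-- first `P`, then `Q` -/
  | seq (P Q : Prog A τ)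
  /-- if `x ∈ T i` then `P` else `Q` -/
  | ite (i : τ) (x : ℕ) (P Q : Prog A τ)
  /-- as long as `x ∉ T i`, do `P` -/
  | untilMem (i : τ) (x : ℕ) (P : Prog A τ)

/-- `Exec T P s t s'`: the program `P`, started with register contents `s`, halts after exactly `t`
steps with register contents `s'`. Every assignment and every test that is carried
out counts as one step. -/
inductive Exec {A τ : Type} [Ring A] (T : τ → Set A) :
    Prog A τ → (ℕ → A) → ℕ → (ℕ → A) → Prop
  | const (x : ℕ) (c : A) (s : ℕ → A) : Exec T (.const x c) s 1 (Function.update s x c)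
  | copy (x y : ℕ) (s : ℕ → A) : Exec T (.copy x y) s 1 (Function.update s x (s y))
  | add (x y z : ℕ) (s : ℕ → A) : Exec T (.add x y z) s 1 (Function.update s x (s y + s z))
  | mul (x y z : ℕ) (s : ℕ → A) : Exec T (.mul x y z) s 1 (Function.update s x (s y * s z))
  | seq {P Q : Prog A τ} {s s' s'' : ℕ → A} {t t' : ℕ} :
      Exec T P s t s' → Exec T Q s' t' s'' → Exec T (.seq P Q) s (t + t') s''
  | ite_pos {i : τ} {x : ℕ} {P Q : Prog A τ} {s s' : ℕ → A} {t : ℕ} :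
      s x ∈ T i → Exec T P s t s' → Exec T (.ite i x P Q) s (t + 1) s'
  | ite_neg {i : τ} {x : ℕ} {P Q : Prog A τ} {s s' : ℕ → A} {t : ℕ} :
      s x ∉ T i → Exec T Q s t s' → Exec T (.ite i x P Q) s (t + 1) s'
  | until_done {i : τ} {x : ℕ} {P : Prog A τ} {s : ℕ → A} :
      s x ∈ T i → Exec T (.untilMem i x P) s 1 s
  | until_step {i : τ} {x : ℕ} {P : Prog A τ} {s s' s'' : ℕ → A} {t t' : ℕ} :
      s x ∉ T i → Exec T P s t s' → Exec T (.untilMem i x P) s' t' s'' →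
        Exec T (.untilMem i x P) s (t + 1 + t') s''

/-- Execution is deterministic, so that the running time is well defined. -/
theorem Exec.deterministic {A τ : Type} [Ring A] {T : τ → Set A} {P : Prog A τ}
    {s s₁ s₂ : ℕ → A} {t₁ t₂ : ℕ} (h₁ : Exec T P s t₁ s₁) (h₂ : Exec T P s t₂ s₂) :
    t₁ = t₂ ∧ s₁ = s₂ := by
  induction h₁ generalizing t₂ s₂ with
  | const => cases h₂; exact ⟨rfl, rfl⟩
  | copy => cases h₂; exact ⟨rfl, rfl⟩
  | add => cases h₂; exact ⟨rfl, rfl⟩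
  | mul => cases h₂; exact ⟨rfl, rfl⟩
  | seq _ _ ih ih' =>
    cases h₂ with
    | seq k k' =>
      obtain ⟨rfl, rfl⟩ := ih k
      obtain ⟨rfl, rfl⟩ := ih' k'
      exact ⟨rfl, rfl⟩
  | ite_pos h _ ih =>
    cases h₂ with
    | ite_pos _ k => obtain ⟨rfl, rfl⟩ := ih k; exact ⟨rfl, rfl⟩
    | ite_neg h' _ => exact absurd h h'
  | ite_neg h _ ih =>
    cases h₂ with
    | ite_pos h' _ => exact absurd h' h
    | ite_neg _ k => obtain ⟨rfl, rfl⟩ := ih k; exact ⟨rfl, rfl⟩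
  | until_done h =>
    cases h₂ with
    | until_done => exact ⟨rfl, rfl⟩
    | until_step h' => exact absurd h h'
  | until_step h _ _ ih ih' =>
    cases h₂ with
    | until_done h' => exact absurd h' h
    | until_step _ k k' =>
      obtain ⟨rfl, rfl⟩ := ih k
      obtain ⟨rfl, rfl⟩ := ih' k'
      exact ⟨rfl, rfl⟩

/-- The two tests that programs may use: membership in `R₀(M)` and in `R₀(pM)`. -/
def orderTest {A : Type} [Ring A] (R₀M R₀pM : Subring A) : Bool → Set A
  | false => R₀M
  | true => R₀pM

/-- Input convention: the input is in register `0`, and all other registers are `0`. -/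
def inputState {A : Type} [Ring A] (g : A) : ℕ → A := fun k => if k = 0 then g else 0

end

/-!
The radial system exists and is unique because the Bruhat–Tits tree is a tree on which the given
elements act with all the local transitivity that is needed; no approximation theorem enters.

*The tree.* Every vertex is `g v_*` with `g ∈ GL₂(ℚ_p)` a primitive integral matrix, and the
distance from `g v_*` to `v_*` is the exponent `m` in the quotient `p ^ m` of the elementary
divisors of `g` (`spread`, `height`, `depth_eq_height`). The neighbors of `g v_*` correspond to the
lines in `𝔽_p²`. The neighbor that belongs to the kernel of `g` modulo `p` is closer to `v_*`, and
all others are farther away: this is `exists_lower_neighbor` and `lower_neighbor_unique`.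
Consequently depths of neighbors differ by exactly one and every `v ≠ v_*` has one parent.

*The radial system.* By their local form the inverses of the `γ_i` move `v̂_*` to each neighbor of
`v_*` exactly once. As `ω_p` exchanges `v_*` and `v̂_*`, the inverses of the `γ̃_i` move `v_*` to
each neighbor of `v̂_*` exactly once (`isLocallySimplyTransitive`). Hence, once `γ_w` is known for
the parent `w` of `v`, there is exactly one product `γ_i γ_w` (for odd `v`) or `γ̃_i γ_w` (for even
`v`) that is compatible with `v`, and the conditions force `γ_v` to be this product. Recursion on
the depth gives existence, and induction on the depth gives uniqueness (`isRadialSystem_iff`).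

*The algorithm.* The elements of `R₀(M) ⊗ ℤ[1/p]` with reduced norm `p ^ m` that lie in `R₀(M)` are
those that move `v_*` by at most `m` (`mem_order_iff_depth_le`): coordinates with respect to a basis
of the order lie in `ℤ[1/p] ∩ ℤ_p = ℤ`, and `ι_p` turns the reduced norm into the determinant. So
membership tests detect which neighbor of a vertex is closer to `u = g⁻¹ v_*`. The program keeps
`g = x y` with `y = γ_v` for a vertex `v` on the path from `v_*` to `u`, and moves `v` along this
path; by the triangle inequality a step towards `u` leads away from `v_*`, so that it is a step of
the radial system (`radialVertex_of_step_closer`). When `v = u`, one last search finds the coset of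
`x ∈ Γ₀(M)` modulo `Γ₀(pM)`. Each step along the path costs a bounded number of operations.
-/

noncomputable section

/-! ### Matrices over `ℚ_p` -/

section PadicMatrices

variable {p : ℕ} [Fact p.Prime]

theorem padic_p_ne_zero : (p : ℚ_[p]) ≠ 0 := Nat.cast_ne_zero.mpr (Fact.out : p.Prime).ne_zero

/-- The valuation on `ℚ_p` is discrete, with uniformizer `p`. -/
theorem padic_norm_le_inv_of_lt_one {x : ℚ_[p]} (hx : ‖x‖ < 1) : ‖x‖ ≤ (p : ℝ)⁻¹ := by
  have := (Padic.norm_le_pow_iff_norm_lt_pow_add_one x (-1)).2 (by simpa using hx)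
  simpa using this

theorem padic_norm_div_p_le_one_iff {x : ℚ_[p]} : ‖x / p‖ ≤ 1 ↔ ‖x‖ < 1 := by
  have hp : (0 : ℝ) < p := by exact_mod_cast (Fact.out : p.Prime).pos
  rw [norm_div, Padic.norm_p, div_inv_eq_mul]
  constructor
  · intro h
    have h1 : (1 : ℝ) < p := by exact_mod_cast (Fact.out : p.Prime).one_lt
    by_contra! h2
    nlinarith
  · intro h
    have := padic_norm_le_inv_of_lt_one h
    calc ‖x‖ * p ≤ (p : ℝ)⁻¹ * p := by gcongr
      _ = 1 := inv_mul_cancel₀ hp.ne'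

theorem padic_norm_add_le_of_le {x y : ℚ_[p]} {r : ℝ} (hx : ‖x‖ ≤ r) (hy : ‖y‖ ≤ r) :
    ‖x + y‖ ≤ r :=
  (Padic.nonarchimedean x y).trans (max_le hx hy)

theorem padic_norm_sub_le_of_le {x y : ℚ_[p]} {r : ℝ} (hx : ‖x‖ ≤ r) (hy : ‖y‖ ≤ r) :
    ‖x - y‖ ≤ r := by
  rw [sub_eq_add_neg]
  exact padic_norm_add_le_of_le hx (by rwa [norm_neg])

theorem padic_norm_add_lt_of_lt {x y : ℚ_[p]} {r : ℝ} (hx : ‖x‖ < r) (hy : ‖y‖ < r) :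
    ‖x + y‖ < r :=
  (Padic.nonarchimedean x y).trans_lt (max_lt hx hy)

theorem padic_norm_sub_lt_of_lt {x y : ℚ_[p]} {r : ℝ} (hx : ‖x‖ < r) (hy : ‖y‖ < r) :
    ‖x - y‖ < r := by
  rw [sub_eq_add_neg]
  exact padic_norm_add_lt_of_lt hx (by rwa [norm_neg])

theorem padic_norm_mul_le_one {x y : ℚ_[p]} (hx : ‖x‖ ≤ 1) (hy : ‖y‖ ≤ 1) : ‖x * y‖ ≤ 1 := by
  rw [norm_mul]
  exact mul_le_one₀ hx (norm_nonneg _) hy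

theorem padic_norm_mul_lt_one {x y : ℚ_[p]} (hx : ‖x‖ < 1) (hy : ‖y‖ ≤ 1) : ‖x * y‖ < 1 := by
  rw [norm_mul]
  exact mul_lt_one_of_nonneg_of_lt_one_left (norm_nonneg _) hx hy

/-- The largest absolute value of an entry. -/
def entryNorm (X : Matrix (Fin 2) (Fin 2) ℚ_[p]) : ℝ :=
  (Finset.univ : Finset (Fin 2 × Fin 2)).sup' Finset.univ_nonempty fun q => ‖X q.1 q.2‖

theorem entryNorm_le_iff {X : Matrix (Fin 2) (Fin 2) ℚ_[p]} {r : ℝ} :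
    entryNorm X ≤ r ↔ ∀ i j, ‖X i j‖ ≤ r := by
  rw [entryNorm, Finset.sup'_le_iff]
  exact ⟨fun h i j => h (i, j) (Finset.mem_univ _), fun h q _ => h q.1 q.2⟩

theorem entryNorm_lt_iff {X : Matrix (Fin 2) (Fin 2) ℚ_[p]} {r : ℝ} :
    entryNorm X < r ↔ ∀ i j, ‖X i j‖ < r := by
  rw [entryNorm, Finset.sup'_lt_iff]
  exact ⟨fun h i j => h (i, j) (Finset.mem_univ _), fun h q _ => h q.1 q.2⟩

theorem norm_le_entryNorm (X : Matrix (Fin 2) (Fin 2) ℚ_[p]) (i j : Fin 2) :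
    ‖X i j‖ ≤ entryNorm X :=
  entryNorm_le_iff.1 le_rfl i j

theorem exists_norm_eq_entryNorm (X : Matrix (Fin 2) (Fin 2) ℚ_[p]) :
    ∃ i j, entryNorm X = ‖X i j‖ := by
  obtain ⟨q, -, hq⟩ := Finset.exists_mem_eq_sup' (s := (Finset.univ : Finset (Fin 2 × Fin 2)))
    Finset.univ_nonempty fun q => ‖X q.1 q.2‖
  exact ⟨q.1, q.2, hq⟩

theorem entryNorm_nonneg (X : Matrix (Fin 2) (Fin 2) ℚ_[p]) : 0 ≤ entryNorm X :=
  (norm_nonneg _).trans (norm_le_entryNorm X 0 0)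

theorem entryNorm_mul_le (X Y : Matrix (Fin 2) (Fin 2) ℚ_[p]) :
    entryNorm (X * Y) ≤ entryNorm X * entryNorm Y := by
  refine entryNorm_le_iff.2 fun i j => ?_
  rw [Matrix.mul_apply, Fin.sum_univ_two]
  have h : ∀ k, ‖X i k * Y k j‖ ≤ entryNorm X * entryNorm Y := fun k => by
    rw [norm_mul]
    exact mul_le_mul (norm_le_entryNorm _ _ _) (norm_le_entryNorm _ _ _) (norm_nonneg _)
      (entryNorm_nonneg _)
  exact padic_norm_add_le_of_le (h 0) (h 1)

theorem entryNorm_smul (c : ℚ_[p]) (X : Matrix (Fin 2) (Fin 2) ℚ_[p]) :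
    entryNorm (c • X) = ‖c‖ * entryNorm X := by
  apply le_antisymm
  · refine entryNorm_le_iff.2 fun i j => ?_
    rw [Matrix.smul_apply, smul_eq_mul, norm_mul]
    gcongr
    exact norm_le_entryNorm X i j
  · obtain ⟨i, j, h⟩ := exists_norm_eq_entryNorm X
    rw [h, ← norm_mul]
    exact norm_le_entryNorm (c • X) i j

theorem norm_det_le {X : Matrix (Fin 2) (Fin 2) ℚ_[p]} (hX : entryNorm X ≤ 1) : ‖X.det‖ ≤ 1 := by
  rw [entryNorm_le_iff] at hX
  rw [Matrix.det_fin_two]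
  exact padic_norm_sub_le_of_le (padic_norm_mul_le_one (hX _ _) (hX _ _))
    (padic_norm_mul_le_one (hX _ _) (hX _ _))

theorem det_ne_zero_GL (g : GL (Fin 2) ℚ_[p]) : g.1.det ≠ 0 :=
  ((Matrix.isUnit_iff_isUnit_det _).1 g.isUnit).ne_zero

theorem entryNorm_pos (g : GL (Fin 2) ℚ_[p]) : 0 < entryNorm g.1 := by
  refine (entryNorm_nonneg _).lt_of_ne' fun h => det_ne_zero_GL g ?_
  have h0 : ∀ i j, g.1 i j = 0 := fun i j =>
    norm_le_zero_iff.1 ((norm_le_entryNorm g.1 i j).trans h.le)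
  rw [Matrix.det_fin_two]
  simp [h0]

theorem GL_inv_apply (g : GL (Fin 2) ℚ_[p]) :
    (g⁻¹).1 = (g.1.det)⁻¹ • !![g.1 1 1, -g.1 0 1; -g.1 1 0, g.1 0 0] := by
  rw [Matrix.coe_units_inv, Matrix.inv_def, Ring.inverse_eq_inv', Matrix.adjugate_fin_two]

theorem entryNorm_adjugate (X : Matrix (Fin 2) (Fin 2) ℚ_[p]) :
    entryNorm !![X 1 1, -X 0 1; -X 1 0, X 0 0] = entryNorm X := by
  apply le_antisymm
  · refine entryNorm_le_iff.2 fun i j => ?_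
    fin_cases i <;> fin_cases j <;> simp [norm_le_entryNorm]
  · refine entryNorm_le_iff.2 fun i j => ?_
    have h := norm_le_entryNorm !![X 1 1, -X 0 1; -X 1 0, X 0 0]
    fin_cases i <;> fin_cases j
    · simpa using h 1 1
    · simpa using h 0 1
    · simpa using h 1 0
    · simpa using h 0 0

theorem entryNorm_inv (g : GL (Fin 2) ℚ_[p]) :
    entryNorm (g⁻¹).1 = ‖g.1.det‖⁻¹ * entryNorm g.1 := by
  rw [GL_inv_apply, entryNorm_smul, entryNorm_adjugate, norm_inv]

/-- Membership in `GL₂(ℤ_p)`. -/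
def IsIntegralGL (k : GL (Fin 2) ℚ_[p]) : Prop := entryNorm k.1 ≤ 1 ∧ ‖k.1.det‖ = 1

theorem IsIntegralGL.inv {k : GL (Fin 2) ℚ_[p]} (hk : IsIntegralGL k) : IsIntegralGL k⁻¹ := by
  constructor
  · rw [entryNorm_inv, hk.2]
    simpa using hk.1
  · rw [Matrix.coe_units_inv, Matrix.det_nonsing_inv, Ring.inverse_eq_inv', norm_inv, hk.2, inv_one]

theorem isIntegralGL_of_inv {k : GL (Fin 2) ℚ_[p]} (h : entryNorm k.1 ≤ 1)
    (h' : entryNorm (k⁻¹).1 ≤ 1) : IsIntegralGL k := by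
  refine ⟨h, le_antisymm (norm_det_le h) ?_⟩
  have h1 := norm_det_le h'
  rw [Matrix.coe_units_inv, Matrix.det_nonsing_inv, Ring.inverse_eq_inv', norm_inv] at h1
  have h0 : 0 < ‖k.1.det‖ := norm_pos_iff.2 (det_ne_zero_GL k)
  exact (inv_le_one₀ h0).1 h1

theorem entryNorm_mul_right (X : Matrix (Fin 2) (Fin 2) ℚ_[p]) {k : GL (Fin 2) ℚ_[p]}
    (hk : IsIntegralGL k) : entryNorm (X * k.1) = entryNorm X := by
  have key : ∀ (X : Matrix (Fin 2) (Fin 2) ℚ_[p]) {k : GL (Fin 2) ℚ_[p]}, IsIntegralGL k →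
      entryNorm (X * k.1) ≤ entryNorm X := fun X k hk =>
    (entryNorm_mul_le _ _).trans (mul_le_of_le_one_right (entryNorm_nonneg _) hk.1)
  refine le_antisymm (key X hk) ?_
  have := key (X * k.1) hk.inv
  rwa [mul_assoc, ← Units.val_mul, mul_inv_cancel, Units.val_one, mul_one] at this

@[simp]
theorem scalarGL_val (c : ℚ_[p]ˣ) : (scalarGL c).1 = algebraMap ℚ_[p] _ (c : ℚ_[p]) := rfl

theorem scalarGL_mul_val (c : ℚ_[p]ˣ) (g : GL (Fin 2) ℚ_[p]) :
    (scalarGL c * g).1 = (c : ℚ_[p]) • g.1 := by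
  rw [Units.val_mul, scalarGL_val, Algebra.smul_def]

end PadicMatrices

/-! ### Lattices and the stabilizers of `v_*` and `e_*` -/

section Lattices

variable {p : ℕ} [Fact p.Prime]

variable (p) in
/-- The lattice `ℤ_p ⊕ ℤ_p`. -/
abbrev stdLattice : PLattice p := diagLattice (1 : ℚ_[p]) one_ne_zero

theorem mem_diagLattice {c : ℚ_[p]} (hc : c ≠ 0) {x : Fin 2 → ℚ_[p]} :
    x ∈ (diagLattice c hc).carrier ↔ ‖x 0‖ ≤ 1 ∧ ‖x 1‖ ≤ ‖c‖ := by
  change x ∈ Submodule.span ℤ_[p] {![1, 0], ![0, c]} ↔ _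
  rw [Submodule.mem_span_pair]
  constructor
  · rintro ⟨r, s, rfl⟩
    refine ⟨by simpa [Algebra.smul_def] using r.2, ?_⟩
    simpa [Algebra.smul_def] using mul_le_of_le_one_left (norm_nonneg c) s.2
  · rintro ⟨h0, h1⟩
    have hs : ‖x 1 / c‖ ≤ 1 := by
      rw [norm_div]
      exact div_le_one_of_le₀ h1 (norm_nonneg _)
    obtain ⟨r, hr⟩ : ∃ r : ℤ_[p], (r : ℚ_[p]) = x 0 := ⟨⟨x 0, h0⟩, rfl⟩
    obtain ⟨s, hs⟩ : ∃ s : ℤ_[p], (s : ℚ_[p]) = x 1 / c := ⟨⟨x 1 / c, hs⟩, rfl⟩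
    refine ⟨r, s, ?_⟩
    ext i
    fin_cases i <;> simp [Algebra.smul_def, hr, hs, hc]

theorem mem_stdLattice {x : Fin 2 → ℚ_[p]} :
    x ∈ (stdLattice p).carrier ↔ ‖x 0‖ ≤ 1 ∧ ‖x 1‖ ≤ 1 := by
  rw [mem_diagLattice, norm_one]

theorem mem_smul_lattice {g : GL (Fin 2) ℚ_[p]} {L : PLattice p} {x : Fin 2 → ℚ_[p]} :
    x ∈ (g • L).carrier ↔ (g⁻¹).1 *ᵥ x ∈ L.carrier := by
  change x ∈ L.carrier.map (matAct g.1) ↔ _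
  rw [Submodule.mem_map]
  constructor
  · rintro ⟨y, hy, rfl⟩
    have : (g⁻¹).1 *ᵥ (matAct g.1 y) = y := by
      change (g⁻¹).1 *ᵥ (g.1 *ᵥ y) = y
      rw [Matrix.mulVec_mulVec, ← Units.val_mul, inv_mul_cancel, Units.val_one, Matrix.one_mulVec]
    rwa [this]
  · intro h
    refine ⟨_, h, ?_⟩
    change g.1 *ᵥ ((g⁻¹).1 *ᵥ x) = x
    rw [Matrix.mulVec_mulVec, ← Units.val_mul, mul_inv_cancel, Units.val_one, Matrix.one_mulVec]

theorem smul_lattice_eq_of {g : GL (Fin 2) ℚ_[p]} {L : PLattice p}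
    (h : ∀ x ∈ L.carrier, g.1 *ᵥ x ∈ L.carrier) (h' : ∀ x ∈ L.carrier, (g⁻¹).1 *ᵥ x ∈ L.carrier) :
    g • L = L := by
  ext x
  rw [mem_smul_lattice]
  refine ⟨fun hx => ?_, h' x⟩
  have := h _ hx
  rwa [Matrix.mulVec_mulVec, ← Units.val_mul, mul_inv_cancel, Units.val_one,
    Matrix.one_mulVec] at this

theorem mulVec_two (X : Matrix (Fin 2) (Fin 2) ℚ_[p]) (x : Fin 2 → ℚ_[p]) (i : Fin 2) :
    (X *ᵥ x) i = X i 0 * x 0 + X i 1 * x 1 := by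
  simp [Matrix.mulVec, dotProduct, Fin.sum_univ_two]

theorem mulVec_mem_stdLattice {X : Matrix (Fin 2) (Fin 2) ℚ_[p]} (hX : entryNorm X ≤ 1)
    {x : Fin 2 → ℚ_[p]} (hx : x ∈ (stdLattice p).carrier) : X *ᵥ x ∈ (stdLattice p).carrier := by
  rw [mem_stdLattice] at hx ⊢
  rw [entryNorm_le_iff] at hX
  simp only [mulVec_two]
  exact ⟨padic_norm_add_le_of_le (padic_norm_mul_le_one (hX _ _) hx.1)
      (padic_norm_mul_le_one (hX _ _) hx.2),
    padic_norm_add_le_of_le (padic_norm_mul_le_one (hX _ _) hx.1)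
      (padic_norm_mul_le_one (hX _ _) hx.2)⟩

theorem smul_stdLattice_eq_iff {k : GL (Fin 2) ℚ_[p]} :
    k • stdLattice p = stdLattice p ↔ IsIntegralGL k := by
  have key : ∀ k : GL (Fin 2) ℚ_[p], k • stdLattice p = stdLattice p → entryNorm (k⁻¹).1 ≤ 1 := by
    intro k h
    have h0 : ∀ x ∈ (stdLattice p).carrier, (k⁻¹).1 *ᵥ x ∈ (stdLattice p).carrier := fun x hx => by
      rwa [← mem_smul_lattice, h]
    have e0 := mem_stdLattice.1 (h0 ![1, 0] (mem_stdLattice.2 (by simp)))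
    have e1 := mem_stdLattice.1 (h0 ![0, 1] (mem_stdLattice.2 (by simp)))
    simp only [mulVec_two] at e0 e1
    refine entryNorm_le_iff.2 fun i j => ?_
    fin_cases i <;> fin_cases j
    · simpa using e0.1
    · simpa using e1.1
    · simpa using e0.2
    · simpa using e1.2
  constructor
  · intro h
    refine isIntegralGL_of_inv ?_ (key k h)
    simpa using key k⁻¹ (by rw [inv_smul_eq_iff, h])
  · intro h
    exact smul_lattice_eq_of (fun x hx => mulVec_mem_stdLattice h.1 hx)
      fun x hx => mulVec_mem_stdLattice h.inv.1 hx

theorem scalarGL_smul_vertex (c : ℚ_[p]ˣ) (v : Vertex p) : scalarGL c • v = v := by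
  induction v using Quotient.inductionOn with
  | h L => exact (Quotient.sound ⟨c, rfl⟩ : L.toVertex = (scalarGL c • L).toVertex).symm

theorem smul_vStar_eq_vStar {k : GL (Fin 2) ℚ_[p]} (hk : IsIntegralGL k) :
    k • vStar p = vStar p := by
  rw [vStar, smul_toVertex, smul_stdLattice_eq_iff.2 hk]

/-- The stabilizer of `v_*` in `GL₂(ℚ_p)` is `ℚ_pˣ GL₂(ℤ_p)`. -/
theorem exists_scalar_of_smul_vStar {g : GL (Fin 2) ℚ_[p]} (h : g • vStar p = vStar p) :
    ∃ c : ℚ_[p]ˣ, IsIntegralGL (scalarGL c * g) := by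
  obtain ⟨c, hc⟩ := Quotient.exact (s := homothety p) h
  exact ⟨c, smul_stdLattice_eq_iff.1 (by rw [mul_smul]; exact hc.symm)⟩

/-- Every lattice has a basis. -/
theorem exists_smul_stdLattice (L : PLattice p) : ∃ g : GL (Fin 2) ℚ_[p], L = g • stdLattice p := by
  have : L.carrier.IsLattice ℚ_[p] := ⟨L.fg, L.span_eq_top⟩
  let b := (Module.Free.chooseBasis ℤ_[p] L.carrier)
  let B := b.extendOfIsLattice ℚ_[p]
  have hcard : Fintype.card (Module.Free.ChooseBasisIndex ℤ_[p] L.carrier) =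
      Fintype.card (Fin 2) := by
    rw [← Module.finrank_eq_card_basis B]
    simp
  let e := Fintype.equivOfCardEq hcard
  let B' := B.reindex e
  have hB' : ∀ i, B' i = (b (e.symm i) : Fin 2 → ℚ_[p]) := fun i => by
    simp [B', B]
  let X : Matrix (Fin 2) (Fin 2) ℚ_[p] := Matrix.of fun i j => B' j i
  have hX : IsUnit X := by
    have : X = (Pi.basisFun ℚ_[p] (Fin 2)).toMatrix B' := by
      ext i j
      simp [X, Module.Basis.toMatrix_apply]
    rw [this]
    let _ := (Pi.basisFun ℚ_[p] (Fin 2)).invertibleToMatrix B'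
    exact isUnit_of_invertible _
  obtain ⟨g, hg⟩ := hX
  have hmul : ∀ z : Fin 2 → ℚ_[p], g.1 *ᵥ z = z 0 • B' 0 + z 1 • B' 1 := by
    intro z
    ext i
    rw [mulVec_two, hg]
    simp [X, mul_comm]
  refine ⟨g, ?_⟩
  ext x
  rw [mem_smul_lattice, mem_stdLattice]
  have hx : x = g.1 *ᵥ ((g⁻¹).1 *ᵥ x) := by
    rw [Matrix.mulVec_mulVec, ← Units.val_mul, mul_inv_cancel, Units.val_one, Matrix.one_mulVec]
  constructor
  · intro hxL
    let z : Fin 2 → ℚ_[p] := fun i => ((b.repr ⟨x, hxL⟩ (e.symm i) : ℤ_[p]) : ℚ_[p])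
    have hz : x = g.1 *ᵥ z := by
      rw [hmul, ← Fin.sum_univ_two fun i => z i • B' i, ← e.sum_comp fun i => z i • B' i]
      have h1 := congrArg Subtype.val (b.sum_repr ⟨x, hxL⟩)
      rw [Submodule.coe_sum] at h1
      refine h1.symm.trans (Finset.sum_congr rfl fun i _ => ?_)
      simp only [z, hB', Equiv.symm_apply_apply]
      rfl
    have hz' : (g⁻¹).1 *ᵥ x = z := by
      rw [hz, Matrix.mulVec_mulVec, ← Units.val_mul, inv_mul_cancel, Units.val_one,
        Matrix.one_mulVec]
    rw [hz']
    exact ⟨PadicInt.norm_le_one _, PadicInt.norm_le_one _⟩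
  · rintro ⟨h0, h1⟩
    rw [hx, hmul, hB', hB']
    exact L.carrier.add_mem (L.carrier.smul_mem (⟨_, h0⟩ : ℤ_[p]) (b _).2)
      (L.carrier.smul_mem (⟨_, h1⟩ : ℤ_[p]) (b _).2)

theorem exists_smul_vStar (v : Vertex p) : ∃ g : GL (Fin 2) ℚ_[p], v = g • vStar p := by
  induction v using Quotient.inductionOn with
  | h L =>
    obtain ⟨g, rfl⟩ := exists_smul_stdLattice L
    exact ⟨g, rfl⟩

end Lattices

/-! ### Neighbors in the Bruhat–Tits tree -/

section Neighbors

variable {p : ℕ} [Fact p.Prime]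

variable (p) in
/-- The matrix `diag(1, p)`, which sends `v_*` to `v̂_*`. -/
def diagP : GL (Fin 2) ℚ_[p] :=
  Matrix.GeneralLinearGroup.mkOfDetNeZero !![1, 0; 0, (p : ℚ_[p])] (by
    simpa using padic_p_ne_zero)

/-- Representatives of `SL₂(ℤ_p) / {(a b; c d) : c ≡ 0 mod p}`, whose first columns represent the
points of the projective line over `𝔽_p`: the identity and the inverses of `(0 -1; 1 i)`. -/
def lineRep (i : Fin (p + 1)) : GL (Fin 2) ℚ_[p] :=
  if i = 0 then 1 else
    Matrix.GeneralLinearGroup.mkOfDetNeZero !![((i : ℕ) : ℚ_[p]), 1; -1, 0] (by simp)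

theorem diagP_val : (diagP p).1 = !![1, 0; 0, (p : ℚ_[p])] := rfl

theorem lineRep_zero : lineRep (0 : Fin (p + 1)) = 1 := if_pos rfl

theorem lineRep_val {i : Fin (p + 1)} (hi : i ≠ 0) :
    (lineRep i).1 = !![((i : ℕ) : ℚ_[p]), 1; -1, 0] := by
  rw [lineRep, if_neg hi]
  rfl

theorem lineRep_inv_val {i : Fin (p + 1)} (hi : i ≠ 0) :
    ((lineRep i)⁻¹).1 = !![0, -1; 1, ((i : ℕ) : ℚ_[p])] := by
  rw [GL_inv_apply, lineRep_val hi]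
  simp

theorem padic_norm_natCast_le_one (n : ℕ) : ‖(n : ℚ_[p])‖ ≤ 1 := by
  exact_mod_cast Padic.norm_int_le_one (p := p) n

theorem isIntegralGL_lineRep (i : Fin (p + 1)) : IsIntegralGL (lineRep i) := by
  by_cases hi : i = 0
  · subst hi
    rw [lineRep_zero]
    refine ⟨entryNorm_le_iff.2 fun i j => ?_, by simp⟩
    fin_cases i <;> fin_cases j <;> simp
  · rw [IsIntegralGL, lineRep_val hi]
    refine ⟨entryNorm_le_iff.2 fun i j => ?_, by simp⟩
    fin_cases i <;> fin_cases j <;> simp [padic_norm_natCast_le_one]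

theorem diagP_smul_vStar : diagP p • vStar p = vHat p := by
  have : diagP p • stdLattice p = diagLattice (p : ℚ_[p]) padic_p_ne_zero := by
    ext x
    have hx : ((diagP p)⁻¹).1 *ᵥ x = ![x 0, x 1 / p] := by
      rw [GL_inv_apply, diagP_val]
      ext i
      have hp : (p : ℚ_[p]) ≠ 0 := padic_p_ne_zero
      fin_cases i <;> simp [mulVec_two, hp, div_eq_inv_mul]
    rw [mem_smul_lattice, mem_stdLattice, mem_diagLattice, hx]
    have hp : 0 < ‖(p : ℚ_[p])‖ := norm_pos_iff.2 padic_p_ne_zero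
    simp only [Matrix.cons_val_zero, Matrix.cons_val_one, norm_div, div_le_one hp]
  rw [vStar, smul_toVertex, this]
  rfl

/-- The lines in `𝔽_p²` are those spanned by `(1, 0)` and `(i, -1)`, `1 ≤ i ≤ p`. -/
theorem exists_lineRep_inv_mulVec {x : Fin 2 → ℚ_[p]} (h0 : ‖x 0‖ ≤ 1) (h1 : ‖x 1‖ ≤ 1) :
    ∃ i : Fin (p + 1), ‖(((lineRep i)⁻¹).1 *ᵥ x) 1‖ < 1 := by
  by_cases hx : ‖x 1‖ < 1
  · exact ⟨0, by simpa [lineRep_zero] using hx⟩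
  have hx1 : ‖x 1‖ = 1 := le_antisymm h1 (not_lt.1 hx)
  have hne : x 1 ≠ 0 := norm_ne_zero_iff.1 (by rw [hx1]; exact one_ne_zero)
  have hz : ‖-x 0 / x 1‖ ≤ 1 := by rw [norm_div, norm_neg, hx1, div_one]; exact h0
  obtain ⟨n, hn, hmem⟩ := PadicInt.exists_mem_range (⟨-x 0 / x 1, hz⟩ : ℤ_[p])
  have hlt : ‖-x 0 / x 1 - n‖ < 1 := by
    rw [IsLocalRing.mem_maximalIdeal, PadicInt.mem_nonunits] at hmem
    exact_mod_cast hmem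
  -- the residue `0` is represented by `p`
  obtain ⟨m, hm0, hmp, hm⟩ : ∃ m : ℕ, m ≠ 0 ∧ m < p + 1 ∧ ‖-x 0 / x 1 - m‖ < 1 := by
    by_cases h : n = 0
    · refine ⟨p, (Fact.out : p.Prime).ne_zero, by omega, ?_⟩
      subst h
      exact padic_norm_sub_lt_of_lt (by simpa using hlt) Padic.norm_p_lt_one
    · exact ⟨n, h, by omega, hlt⟩
  refine ⟨⟨m, hmp⟩, ?_⟩
  rw [lineRep_inv_val (by simpa [Fin.ext_iff] using hm0), mulVec_two]
  have : x 0 + m * x 1 = (-x 0 / x 1 - m) * -x 1 := by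
    field_simp
    ring
  simpa [this, hx1] using hm

theorem mem_scalarP_smul_stdLattice {x : Fin 2 → ℚ_[p]} :
    x ∈ (scalarP p • stdLattice p).carrier ↔ ‖x 0‖ < 1 ∧ ‖x 1‖ < 1 := by
  have h : ((scalarP p)⁻¹).1 *ᵥ x = fun i => x i / p := by
    rw [scalarP, scalarGL, ← map_inv]
    ext i
    simp [div_eq_inv_mul, Matrix.algebraMap_eq_diagonal, Matrix.mulVec_diagonal]
  rw [mem_smul_lattice, mem_stdLattice, h, padic_norm_div_p_le_one_iff,
    padic_norm_div_p_le_one_iff]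

/-- A lattice strictly between `pℤ_p²` and `ℤ_p²` that contains a vector reducing to a nonzero
multiple of `(1, 0)` is `ℤ_p ⊕ pℤ_p`. -/
theorem toVertex_eq_vHat {L : PLattice p} (h1 : (scalarP p • stdLattice p).carrier ≤ L.carrier)
    (h2 : L.carrier < (stdLattice p).carrier) {x : Fin 2 → ℚ_[p]} (hx : x ∈ L.carrier)
    (hx0 : ‖x 0‖ = 1) (hx1 : ‖x 1‖ < 1) : L.toVertex = vHat p := by
  have hsmul : ∀ {c : ℚ_[p]} {y : Fin 2 → ℚ_[p]}, ‖c‖ ≤ 1 → y ∈ L.carrier → c • y ∈ L.carrier :=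
    fun {c y} hc hy => L.carrier.smul_mem (⟨c, hc⟩ : ℤ_[p]) hy
  have hsmall : ∀ {y : Fin 2 → ℚ_[p]}, ‖y 0‖ < 1 → ‖y 1‖ < 1 → y ∈ L.carrier := by
    exact fun hy0 hy1 => h1 (mem_scalarP_smul_stdLattice.2 ⟨hy0, hy1⟩)
  have hne0 : x 0 ≠ 0 := norm_ne_zero_iff.1 (by rw [hx0]; exact one_ne_zero)
  have he0 : ![1, 0] ∈ L.carrier := by
    have : (![1, 0] : Fin 2 → ℚ_[p]) = (x 0)⁻¹ • (x - ![0, x 1]) := by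
      ext i
      fin_cases i <;> simp [hne0, Matrix.vecHead, Matrix.vecTail]
    rw [this]
    exact hsmul (by rw [norm_inv, hx0, inv_one])
      (L.carrier.sub_mem hx (hsmall (by simp) (by simpa using hx1)))
  have key : L = diagLattice (p : ℚ_[p]) padic_p_ne_zero := by
    ext y
    rw [mem_diagLattice, Padic.norm_p]
    constructor
    · intro hy
      obtain ⟨hy0, hy1⟩ := mem_stdLattice.1 (h2.le hy)
      refine ⟨hy0, padic_norm_le_inv_of_lt_one (lt_of_le_of_ne hy1 fun hy1 => h2.not_ge ?_)⟩
      have hne : y 1 ≠ 0 := norm_ne_zero_iff.1 (by rw [hy1]; exact one_ne_zero)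
      have he1 : ![0, 1] ∈ L.carrier := by
        have : (![0, 1] : Fin 2 → ℚ_[p]) = (y 1)⁻¹ • (y - (y 0) • ![1, 0]) := by
          ext i
          fin_cases i <;> simp [hne, Matrix.vecHead, Matrix.vecTail]
        rw [this]
        exact hsmul (by rw [norm_inv, hy1, inv_one]) (L.carrier.sub_mem hy (hsmul hy0 he0))
      intro z hz
      obtain ⟨hz0, hz1⟩ := mem_stdLattice.1 hz
      have : z = z 0 • ![1, 0] + z 1 • ![0, 1] := by
        ext i
        fin_cases i <;> simp
      rw [this]
      exact L.carrier.add_mem (hsmul hz0 he0) (hsmul hz1 he1)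
    · rintro ⟨hy0, hy1⟩
      have : y = y 0 • ![1, 0] + ![0, y 1] := by
        ext i
        fin_cases i <;> simp
      rw [this]
      have hp1 : (p : ℝ)⁻¹ < 1 := by rw [← Padic.norm_p (p := p)]; exact Padic.norm_p_lt_one
      exact L.carrier.add_mem (hsmul hy0 he0)
        (hsmall (by simp) (by simpa using hy1.trans_lt hp1))
  rw [key]
  rfl

theorem exists_eq_lineRep_smul_vHat {w : Vertex p} (h : Neighbor (vStar p) w) :
    ∃ i : Fin (p + 1), w = lineRep i • vHat p := by
  obtain ⟨L₁, L₂, e1, rfl, h1, h2⟩ := h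
  obtain ⟨c, hc⟩ := Quotient.exact (s := homothety p) e1
  have hcs : scalarGL c • scalarP p • L₁ = scalarP p • stdLattice p := by
    change stdLattice p = _ at hc
    rw [hc, ← mul_smul, scalarGL_comm, mul_smul]
  have h1' : (scalarP p • stdLattice p).carrier < (scalarGL c • L₂).carrier := by
    rw [← hcs]
    exact smul_carrier_lt _ h1
  have h2' : (scalarGL c • L₂).carrier < (stdLattice p).carrier := by
    change stdLattice p = _ at hc
    rw [hc]
    exact smul_carrier_lt _ h2
  have hv : (scalarGL c • L₂).toVertex = L₂.toVertex := scalarGL_smul_vertex c L₂.toVertex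
  rw [← hv]
  generalize scalarGL c • L₂ = L at h1' h2'
  obtain ⟨x, hx, hxn⟩ := SetLike.exists_of_lt h1'
  obtain ⟨hx0, hx1⟩ := mem_stdLattice.1 (h2'.le hx)
  obtain ⟨i, hi⟩ := exists_lineRep_inv_mulVec hx0 hx1
  refine ⟨i, ?_⟩
  rw [← inv_smul_eq_iff, smul_toVertex]
  have hk := (isIntegralGL_lineRep i).inv
  have hstd : (lineRep i)⁻¹ • stdLattice p = stdLattice p := smul_stdLattice_eq_iff.2 hk
  have hsc : (lineRep i)⁻¹ • scalarP p • stdLattice p = scalarP p • stdLattice p := by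
    rw [← mul_smul, scalarP, ← scalarGL_comm, mul_smul, hstd]
  have hy : ((lineRep i)⁻¹).1 *ᵥ x ∈ ((lineRep i)⁻¹ • L).carrier := by
    rw [mem_smul_lattice, Matrix.mulVec_mulVec, ← Units.val_mul, inv_mul_cancel, Units.val_one,
      Matrix.one_mulVec]
    exact hx
  refine toVertex_eq_vHat (hsc ▸ (smul_carrier_lt _ h1').le)
    (lt_of_lt_of_eq (smul_carrier_lt _ h2') (by rw [hstd])) hy ?_ hi
  have hystd := mem_stdLattice.1 (mulVec_mem_stdLattice hk.1 (h2'.le hx))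
  refine le_antisymm hystd.1 (not_lt.1 fun hlt => hxn ?_)
  have hmem := mem_scalarP_smul_stdLattice.2 ⟨hlt, hi⟩
  rwa [← hsc, mem_smul_lattice, inv_inv, Matrix.mulVec_mulVec, ← Units.val_mul, mul_inv_cancel,
    Units.val_one, Matrix.one_mulVec] at hmem

theorem neighbor_lineRep_smul_vHat (i : Fin (p + 1)) :
    Neighbor (vStar p) (lineRep i • vHat p) := by
  have := neighbor_vStar_vHat (p := p).smul (lineRep i)
  rwa [smul_vStar_eq_vStar (isIntegralGL_lineRep i)] at this

variable (p) in
/-- The matrix `(0 -1; p 0)`, which exchanges `v_*` and `v̂_*`. -/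
def swapGL : GL (Fin 2) ℚ_[p] :=
  Matrix.GeneralLinearGroup.mkOfDetNeZero !![0, -1; (p : ℚ_[p]), 0] (by
    simpa using padic_p_ne_zero)

variable (p) in
/-- The matrix `(0 -1; 1 0)`. -/
def weylGL : GL (Fin 2) ℚ_[p] :=
  Matrix.GeneralLinearGroup.mkOfDetNeZero !![0, -1; 1, 0] (by simp)

theorem isIntegralGL_weylGL : IsIntegralGL (weylGL p) := by
  refine ⟨entryNorm_le_iff.2 fun i j => ?_, by simp [weylGL]⟩
  fin_cases i <;> fin_cases j <;> simp [weylGL]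

theorem swapGL_smul_vStar : swapGL p • vStar p = vHat p := by
  have : swapGL p = diagP p * weylGL p := by
    ext i j
    fin_cases i <;> fin_cases j <;> simp [swapGL, diagP, weylGL, Matrix.mul_apply]
  rw [this, mul_smul, smul_vStar_eq_vStar isIntegralGL_weylGL, diagP_smul_vStar]

theorem swapGL_smul_vHat : swapGL p • vHat p = vStar p := by
  have : swapGL p * diagP p = scalarP p * weylGL p := by
    refine Units.ext ?_
    rw [scalarP, scalarGL_mul_val]
    ext i j
    fin_cases i <;> fin_cases j <;> simp [swapGL, diagP, weylGL]
  rw [← diagP_smul_vStar, ← mul_smul, this, mul_smul, smul_vStar_eq_vStar isIntegralGL_weylGL,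
    scalarP, scalarGL_smul_vertex]

theorem neighbor_symm {v w : Vertex p} (h : Neighbor v w) : Neighbor w v := by
  obtain ⟨g, rfl⟩ := exists_smul_vStar v
  have h' := h.smul g⁻¹
  rw [inv_smul_smul] at h'
  obtain ⟨i, hi⟩ := exists_eq_lineRep_smul_vHat h'
  rw [inv_smul_eq_iff] at hi
  subst hi
  have h0 := (neighbor_vStar_vHat (p := p)).smul (swapGL p)
  rw [swapGL_smul_vStar, swapGL_smul_vHat] at h0
  have := (h0.smul (lineRep i)).smul g
  rwa [smul_vStar_eq_vStar (isIntegralGL_lineRep i)] at this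

end Neighbors

/-! ### Elementary divisors and the distance to `v_*` -/

section Height

variable {p : ℕ} [Fact p.Prime]

/-- The quotient of the elementary divisors of `g`, as a real number: `p ^ m` if
`g ∈ GL₂(ℤ_p) diag(p ^ i, p ^ (i + m)) GL₂(ℤ_p)`. -/
def spread (g : GL (Fin 2) ℚ_[p]) : ℝ := entryNorm g.1 ^ 2 / ‖g.1.det‖

theorem spread_scalarGL_mul (c : ℚ_[p]ˣ) (g : GL (Fin 2) ℚ_[p]) :
    spread (scalarGL c * g) = spread g := by
  have hc : ‖(c : ℚ_[p])‖ ≠ 0 := norm_ne_zero_iff.2 c.ne_zero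
  rw [spread, spread, scalarGL_mul_val, entryNorm_smul, Matrix.det_smul]
  simp only [Fintype.card_fin, norm_mul, norm_pow]
  rw [mul_pow, mul_div_mul_left _ _ (pow_ne_zero 2 hc)]

theorem spread_mul_right (g : GL (Fin 2) ℚ_[p]) {k : GL (Fin 2) ℚ_[p]} (hk : IsIntegralGL k) :
    spread (g * k) = spread g := by
  rw [spread, spread, Units.val_mul, entryNorm_mul_right _ hk, Matrix.det_mul, norm_mul, hk.2,
    mul_one]

theorem spread_eq_of_smul_eq {g h : GL (Fin 2) ℚ_[p]} (e : g • vStar p = h • vStar p) :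
    spread g = spread h := by
  obtain ⟨c, hc⟩ := exists_scalar_of_smul_vStar (g := g⁻¹ * h) (by
    rw [mul_smul, ← e, inv_smul_smul])
  rw [← spread_mul_right g hc, ← mul_assoc, ← scalarGL_comm, mul_assoc, mul_inv_cancel_left,
    spread_scalarGL_mul]

theorem exists_entryNorm_scalarGL_mul (g : GL (Fin 2) ℚ_[p]) :
    ∃ c : ℚ_[p]ˣ, entryNorm (scalarGL c * g).1 = 1 := by
  obtain ⟨i, j, h⟩ := exists_norm_eq_entryNorm g.1
  have hpos := entryNorm_pos g
  have hne : g.1 i j ≠ 0 := norm_ne_zero_iff.1 (by rw [← h]; exact hpos.ne')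
  refine ⟨(Units.mk0 _ hne)⁻¹, ?_⟩
  rw [scalarGL_mul_val, entryNorm_smul, Units.val_inv_eq_inv_val, Units.val_mk0, norm_inv, ← h,
    inv_mul_cancel₀ hpos.ne']

/-- Every vertex is represented by a primitive matrix. -/
theorem exists_primitive_smul_vStar (v : Vertex p) :
    ∃ g : GL (Fin 2) ℚ_[p], entryNorm g.1 = 1 ∧ v = g • vStar p := by
  obtain ⟨g, rfl⟩ := exists_smul_vStar v
  obtain ⟨c, hc⟩ := exists_entryNorm_scalarGL_mul g
  exact ⟨_, hc, by rw [mul_smul, scalarGL_smul_vertex]⟩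

theorem padic_one_lt_p : (1 : ℝ) < p := by exact_mod_cast (Fact.out : p.Prime).one_lt

theorem exists_height (v : Vertex p) : ∃ m : ℕ, ∀ g : GL (Fin 2) ℚ_[p], v = g • vStar p →
    spread g = (p : ℝ) ^ m := by
  obtain ⟨g, hg, rfl⟩ := exists_primitive_smul_vStar v
  have hd : ‖g.1.det‖ ≤ 1 := norm_det_le hg.le
  have hv := Padic.norm_eq_zpow_neg_valuation (det_ne_zero_GL g)
  have h0 : 0 ≤ g.1.det.valuation := by
    rw [hv, zpow_le_one_iff_right₀ padic_one_lt_p] at hd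
    omega
  refine ⟨g.1.det.valuation.toNat, fun h e => ?_⟩
  rw [← spread_eq_of_smul_eq e, spread, hg, hv, one_pow, zpow_neg, one_div, inv_inv,
    ← zpow_natCast, Int.toNat_of_nonneg h0]

/-- The number `m` such that `v = g v_*` for some `g ∈ GL₂(ℤ_p) diag(1, p ^ m)`. It is the distance
from `v` to `v_*`. -/
def height (v : Vertex p) : ℕ := (exists_height v).choose

theorem spread_eq_pow_height (g : GL (Fin 2) ℚ_[p]) : spread g = (p : ℝ) ^ height (g • vStar p) :=
  (exists_height (g • vStar p)).choose_spec g rfl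

theorem height_vStar : height (vStar p) = 0 := by
  have h := spread_eq_pow_height (1 : GL (Fin 2) ℚ_[p])
  have h1 : spread (1 : GL (Fin 2) ℚ_[p]) = 1 := by
    have : entryNorm (1 : GL (Fin 2) ℚ_[p]).1 = 1 := by
      refine le_antisymm (entryNorm_le_iff.2 fun i j => ?_) ?_
      · fin_cases i <;> fin_cases j <;> simp
      · simpa using norm_le_entryNorm (1 : GL (Fin 2) ℚ_[p]).1 0 0
    rw [spread, this]
    simp
  rw [h1, one_smul] at h
  by_contra h0
  exact (one_lt_pow₀ padic_one_lt_p h0).ne h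

theorem eq_vStar_of_height_eq_zero {v : Vertex p} (h : height v = 0) : v = vStar p := by
  obtain ⟨g, hg, rfl⟩ := exists_primitive_smul_vStar v
  have hs := spread_eq_pow_height g
  rw [h, pow_zero, spread, hg, one_pow, div_eq_one_iff_eq
    (norm_ne_zero_iff.2 (det_ne_zero_GL g))] at hs
  exact smul_vStar_eq_vStar ⟨hg.le, hs.symm⟩

theorem spread_mul_diagP_of_lt {g : GL (Fin 2) ℚ_[p]} (hg : entryNorm g.1 = 1)
    (h : ‖g.1 0 0‖ < 1 ∧ ‖g.1 1 0‖ < 1) : p * spread (g * diagP p) = spread g := by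
  have hp : (p : ℝ) ≠ 0 := (zero_lt_one.trans padic_one_lt_p).ne'
  have hN : entryNorm (g * diagP p).1 = (p : ℝ)⁻¹ := by
    have hle := entryNorm_le_iff.1 hg.le
    apply le_antisymm
    · refine entryNorm_le_iff.2 fun i j => ?_
      rw [Units.val_mul, diagP_val, Matrix.mul_apply, Fin.sum_univ_two]
      have h0 := padic_norm_le_inv_of_lt_one h.1
      have h1 := padic_norm_le_inv_of_lt_one h.2
      fin_cases i <;> fin_cases j
      · simpa using h0
      · simpa using mul_le_of_le_one_left (by positivity) (hle 0 1)
      · simpa using h1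
      · simpa using mul_le_of_le_one_left (by positivity) (hle 1 1)
    · obtain ⟨i, j, hij⟩ := exists_norm_eq_entryNorm g.1
      rw [hg] at hij
      have hj : j = 1 := by
        by_contra hj
        obtain rfl : j = 0 := by omega
        fin_cases i
        · exact h.1.ne hij.symm
        · exact h.2.ne hij.symm
      subst hj
      have := norm_le_entryNorm (g * diagP p).1 i 1
      have h1 : (g * diagP p).1 i 1 = g.1 i 1 * p := by
        rw [Units.val_mul, diagP_val, Matrix.mul_apply, Fin.sum_univ_two]
        simp
      rwa [h1, norm_mul, ← hij, one_mul, Padic.norm_p] at this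
  rw [spread, spread, hN, hg, Units.val_mul, Matrix.det_mul, diagP_val]
  simp
  field_simp

theorem spread_mul_diagP_of_not_lt {g : GL (Fin 2) ℚ_[p]} (hg : entryNorm g.1 = 1)
    (h : ¬ (‖g.1 0 0‖ < 1 ∧ ‖g.1 1 0‖ < 1)) : spread (g * diagP p) = p * spread g := by
  have hN : entryNorm (g * diagP p).1 = 1 := by
    have hle := entryNorm_le_iff.1 hg.le
    apply le_antisymm
    · refine (entryNorm_mul_le _ _).trans (hg.symm ▸ ?_)
      rw [one_mul]
      refine entryNorm_le_iff.2 fun i j => ?_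
      fin_cases i <;> fin_cases j
      all_goals simp [diagP_val]
      exact inv_le_one_of_one_le₀ padic_one_lt_p.le
    · have h0 := norm_le_entryNorm (g * diagP p).1 0 0
      have h1 := norm_le_entryNorm (g * diagP p).1 1 0
      rw [Units.val_mul, diagP_val, Matrix.mul_apply, Fin.sum_univ_two] at h0 h1
      simp only [Matrix.of_apply, Matrix.cons_val', Matrix.cons_val_zero, Matrix.cons_val_one,
        mul_one, mul_zero, add_zero, Matrix.cons_val_fin_one] at h0 h1
      by_contra! hlt
      rw [Units.val_mul, diagP_val] at hlt
      exact h ⟨h0.trans_lt hlt, h1.trans_lt hlt⟩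
  have hp : (p : ℝ) ≠ 0 := (zero_lt_one.trans padic_one_lt_p).ne'
  rw [spread, spread, hN, hg, Units.val_mul, Matrix.det_mul, diagP_val]
  simp [div_eq_mul_inv, mul_comm]

theorem entryNorm_mul_lineRep {g : GL (Fin 2) ℚ_[p]} (hg : entryNorm g.1 = 1)
    (i : Fin (p + 1)) : entryNorm (g * lineRep i).1 = 1 := by
  rw [Units.val_mul, entryNorm_mul_right _ (isIntegralGL_lineRep i), hg]

theorem pow_height_lineRep (g : GL (Fin 2) ℚ_[p]) (i : Fin (p + 1)) :
    (p : ℝ) ^ height (g • lineRep i • vHat p) = spread (g * lineRep i * diagP p) := by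
  rw [spread_eq_pow_height, mul_smul, mul_smul, diagP_smul_vStar]

/-- One step up or down, for the neighbor of `g v_*` that corresponds to the `i`-th line. -/
theorem height_lineRep_cases {g : GL (Fin 2) ℚ_[p]} (hg : entryNorm g.1 = 1) (i : Fin (p + 1)) :
    (height (g • vStar p) = height (g • lineRep i • vHat p) + 1 ∧
      ‖(g * lineRep i).1 0 0‖ < 1 ∧ ‖(g * lineRep i).1 1 0‖ < 1) ∨
    (height (g • lineRep i • vHat p) = height (g • vStar p) + 1 ∧
      ¬ (‖(g * lineRep i).1 0 0‖ < 1 ∧ ‖(g * lineRep i).1 1 0‖ < 1)) := by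
  have hinj := pow_right_injective₀ (zero_lt_one.trans padic_one_lt_p)
    (padic_one_lt_p (p := p)).ne'
  have hN := entryNorm_mul_lineRep hg i
  have hs : spread (g * lineRep i) = (p : ℝ) ^ height (g • vStar p) := by
    rw [spread_mul_right _ (isIntegralGL_lineRep i), spread_eq_pow_height]
  by_cases h : ‖(g * lineRep i).1 0 0‖ < 1 ∧ ‖(g * lineRep i).1 1 0‖ < 1
  · refine Or.inl ⟨hinj ?_, h⟩
    simp only
    rw [pow_succ', pow_height_lineRep, spread_mul_diagP_of_lt hN h, hs]
  · refine Or.inr ⟨hinj ?_, h⟩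
    simp only
    rw [pow_succ', pow_height_lineRep, spread_mul_diagP_of_not_lt hN h, hs]

theorem exists_lineRep_of_neighbor {g : GL (Fin 2) ℚ_[p]} {w : Vertex p}
    (h : Neighbor (g • vStar p) w) : ∃ i : Fin (p + 1), w = g • lineRep i • vHat p := by
  have h' := h.smul g⁻¹
  rw [inv_smul_smul] at h'
  obtain ⟨i, hi⟩ := exists_eq_lineRep_smul_vHat h'
  exact ⟨i, by rw [← hi, smul_inv_smul]⟩

theorem height_neighbor {v w : Vertex p} (h : Neighbor v w) :
    height v = height w + 1 ∨ height w = height v + 1 := by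
  obtain ⟨g, hg, rfl⟩ := exists_primitive_smul_vStar v
  obtain ⟨i, rfl⟩ := exists_lineRep_of_neighbor h
  exact (height_lineRep_cases hg i).imp And.left And.left

/-- The kernel of a primitive singular matrix over `𝔽_p` is a line. -/
theorem exists_lineRep_col_lt {g : GL (Fin 2) ℚ_[p]} (hg : entryNorm g.1 = 1)
    (hd : ‖g.1.det‖ < 1) :
    ∃ i : Fin (p + 1), ‖(g * lineRep i).1 0 0‖ < 1 ∧ ‖(g * lineRep i).1 1 0‖ < 1 := by
  have hle := entryNorm_le_iff.1 hg.le
  -- a primitive column `x` of the adjugate matrix lies in the kernel modulo `p`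
  obtain ⟨x, hx0, hx1, hxn, hk0, hk1⟩ : ∃ x : Fin 2 → ℚ_[p], ‖x 0‖ ≤ 1 ∧ ‖x 1‖ ≤ 1 ∧
      ¬ (‖x 0‖ < 1 ∧ ‖x 1‖ < 1) ∧ ‖(g.1 *ᵥ x) 0‖ < 1 ∧ ‖(g.1 *ᵥ x) 1‖ < 1 := by
    rw [Matrix.det_fin_two] at hd
    by_cases h : ‖g.1 1 1‖ < 1 ∧ ‖g.1 1 0‖ < 1
    · refine ⟨![-g.1 0 1, g.1 0 0], by simpa using hle 0 1, by simpa using hle 0 0, ?_, ?_, ?_⟩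
      · intro h'
        simp only [Matrix.cons_val_zero, Matrix.cons_val_one, norm_neg] at h'
        refine (entryNorm_lt_iff (X := g.1) (r := 1)).2 (fun i j => ?_) |>.ne hg
        fin_cases i <;> fin_cases j
        exacts [h'.2, h'.1, h.2, h.1]
      · rw [mulVec_two]
        simp [mul_comm]
      · rw [mulVec_two]
        convert hd using 2
        simp
        ring
    · refine ⟨![g.1 1 1, -g.1 1 0], by simpa using hle 1 1, by simpa using hle 1 0,
        by simpa using h, ?_, ?_⟩
      · rw [mulVec_two]
        convert hd using 2
        simp
        ring
      · rw [mulVec_two]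
        simp [mul_comm]
  obtain ⟨i, hi⟩ := exists_lineRep_inv_mulVec hx0 hx1
  refine ⟨i, ?_⟩
  set z := ((lineRep i)⁻¹).1 *ᵥ x with hz
  have hxz : x = (lineRep i).1 *ᵥ z := by
    rw [hz, Matrix.mulVec_mulVec, ← Units.val_mul, mul_inv_cancel, Units.val_one,
      Matrix.one_mulVec]
  have hk := entryNorm_le_iff.1 (isIntegralGL_lineRep i).1
  have hzle : ‖z 0‖ ≤ 1 := (mem_stdLattice.1
    (mulVec_mem_stdLattice (isIntegralGL_lineRep i).inv.1 (mem_stdLattice.2 ⟨hx0, hx1⟩))).1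
  have hz0 : ‖z 0‖ = 1 := by
    refine le_antisymm hzle (not_lt.1 fun hlt => hxn ?_)
    rw [hxz, mulVec_two, mulVec_two]
    exact ⟨padic_norm_add_lt_of_lt (mul_comm (z 0) _ ▸ padic_norm_mul_lt_one hlt (hk _ _))
        (mul_comm (z 1) _ ▸ padic_norm_mul_lt_one hi (hk _ _)),
      padic_norm_add_lt_of_lt (mul_comm (z 0) _ ▸ padic_norm_mul_lt_one hlt (hk _ _))
        (mul_comm (z 1) _ ▸ padic_norm_mul_lt_one hi (hk _ _))⟩
  have hgle := entryNorm_le_iff.1 (entryNorm_mul_lineRep hg i).le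
  have key : ∀ j, ‖(g.1 *ᵥ x) j‖ < 1 → ‖(g * lineRep i).1 j 0‖ < 1 := by
    intro j hj
    rw [hxz, Matrix.mulVec_mulVec, ← Units.val_mul, mulVec_two] at hj
    have := padic_norm_sub_lt_of_lt hj
      (mul_comm (z 1) _ ▸ padic_norm_mul_lt_one hi (hgle j 1))
    rwa [add_sub_cancel_right, norm_mul, hz0, mul_one] at this
  exact ⟨key 0 hk0, key 1 hk1⟩

/-- The first columns of the `lineRep i` are pairwise independent modulo `p`. -/
theorem norm_lineRep_cross {i j : Fin (p + 1)} (hij : i ≠ j) :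
    ‖(lineRep i).1 0 0 * (lineRep j).1 1 0 - (lineRep i).1 1 0 * (lineRep j).1 0 0‖ = 1 := by
  by_cases hi : i = 0
  · subst hi
    rw [lineRep_zero, lineRep_val hij.symm]
    simp
  by_cases hj : j = 0
  · subst hj
    rw [lineRep_zero, lineRep_val hi]
    simp
  rw [lineRep_val hi, lineRep_val hj]
  have h : ¬ (p : ℤ) ∣ ((j : ℕ) : ℤ) - ((i : ℕ) : ℤ) := by
    intro hdvd
    have hi' : (i : ℕ) ≠ 0 := fun h => hi (Fin.ext h)
    have hj' : (j : ℕ) ≠ 0 := fun h => hj (Fin.ext h)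
    have := Int.eq_zero_of_abs_lt_dvd hdvd (by rw [abs_lt]; omega)
    exact hij (Fin.ext (by omega))
  have h1 : ‖((((j : ℕ) : ℤ) - ((i : ℕ) : ℤ) : ℤ) : ℚ_[p])‖ = 1 :=
    le_antisymm (Padic.norm_int_le_one _)
      (not_lt.1 fun hlt => h (Padic.norm_intCast_lt_one_iff.1 hlt))
  rw [← h1]
  congr 1
  simp
  ring

theorem lineRep_col_lt_unique {g : GL (Fin 2) ℚ_[p]} (hg : entryNorm g.1 = 1) {i j : Fin (p + 1)}
    (hi : ‖(g * lineRep i).1 0 0‖ < 1 ∧ ‖(g * lineRep i).1 1 0‖ < 1)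
    (hj : ‖(g * lineRep j).1 0 0‖ < 1 ∧ ‖(g * lineRep j).1 1 0‖ < 1) : i = j := by
  by_contra hij
  have hc := norm_lineRep_cross hij
  have hki := entryNorm_le_iff.1 (isIntegralGL_lineRep i).1
  have hkj := entryNorm_le_iff.1 (isIntegralGL_lineRep j).1
  have key : ∀ r, ‖(g * lineRep i).1 r 0‖ < 1 → ‖(g * lineRep j).1 r 0‖ < 1 →
      ∀ s, ‖g.1 r s‖ < 1 := by
    intro r hri hrj s
    have hs : ∀ s', ‖(g * lineRep i).1 r 0 * (lineRep j).1 s' 0 -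
        (g * lineRep j).1 r 0 * (lineRep i).1 s' 0‖ < 1 := fun s' =>
      padic_norm_sub_lt_of_lt (padic_norm_mul_lt_one hri (hkj _ _))
        (padic_norm_mul_lt_one hrj (hki _ _))
    have h0 := hs 0
    have h1 := hs 1
    simp only [Units.val_mul, Matrix.mul_apply, Fin.sum_univ_two] at h0 h1
    obtain rfl | rfl : s = 0 ∨ s = 1 := by omega
    · refine lt_of_eq_of_lt ?_ h1
      rw [← mul_one ‖g.1 r 0‖, ← hc, ← norm_mul]
      congr 1
      ring
    · refine lt_of_eq_of_lt ?_ h0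
      rw [← mul_one ‖g.1 r 1‖, ← hc, ← norm_mul, ← norm_neg]
      congr 1
      ring
  refine (entryNorm_lt_iff (X := g.1) (r := 1)).2 (fun r s => ?_) |>.ne hg
  fin_cases r
  · exact key 0 hi.1 hj.1 s
  · exact key 1 hi.2 hj.2 s

theorem exists_lower_neighbor {v : Vertex p} (h : height v ≠ 0) :
    ∃ w, Neighbor v w ∧ height v = height w + 1 := by
  obtain ⟨g, hg, rfl⟩ := exists_primitive_smul_vStar v
  have hd : ‖g.1.det‖ < 1 := by
    refine lt_of_le_of_ne (norm_det_le hg.le) fun h1 => h ?_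
    rw [smul_vStar_eq_vStar ⟨hg.le, h1⟩, height_vStar]
  obtain ⟨i, hi⟩ := exists_lineRep_col_lt hg hd
  refine ⟨g • lineRep i • vHat p, (neighbor_lineRep_smul_vHat i).smul g, ?_⟩
  exact (height_lineRep_cases hg i).elim And.left fun h => absurd hi h.2

theorem lower_neighbor_unique {v w w' : Vertex p} (hw : Neighbor v w) (hw' : Neighbor v w')
    (h : height w < height v) (h' : height w' < height v) : w = w' := by
  obtain ⟨g, hg, rfl⟩ := exists_primitive_smul_vStar v
  obtain ⟨i, rfl⟩ := exists_lineRep_of_neighbor hw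
  obtain ⟨j, rfl⟩ := exists_lineRep_of_neighbor hw'
  have hi := (height_lineRep_cases hg i).resolve_right fun h => by omega
  have hj := (height_lineRep_cases hg j).resolve_right fun h => by omega
  rw [lineRep_col_lt_unique hg hi.2 hj.2]

theorem lineRep_smul_vHat_injective :
    Function.Injective fun i : Fin (p + 1) => lineRep i • vHat p := by
  intro i j hij
  -- seen from `lineRep i • v̂_*`, the vertex `v_*` is the lower neighbor in both directions
  obtain ⟨c, hc⟩ := exists_entryNorm_scalarGL_mul (lineRep i * diagP p)⁻¹
  have h0 : (scalarGL c * (lineRep i * diagP p)⁻¹) • lineRep i • vHat p = vStar p := by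
    rw [mul_smul, scalarGL_smul_vertex, ← diagP_smul_vStar, ← mul_smul (lineRep i),
      inv_smul_smul]
  have h1 : (scalarGL c * (lineRep i * diagP p)⁻¹) • lineRep j • vHat p = vStar p := by
    rw [← h0]
    exact congrArg _ hij.symm
  have hi := (height_lineRep_cases hc i).resolve_right fun h => by
    rw [h0, height_vStar] at h
    omega
  have hj := (height_lineRep_cases hc j).resolve_right fun h => by
    rw [h1, height_vStar] at h
    omega
  exact lineRep_col_lt_unique hc hi.2 hj.2

end Height

/-! ### The distance on the tree -/

section Distance

variable {p : ℕ} [Fact p.Prime]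

theorem bruhatTits_adj {v w : Vertex p} : (bruhatTits p).Adj v w ↔ Neighbor v w := by
  rw [bruhatTits, SimpleGraph.fromRel_adj]
  constructor
  · rintro ⟨-, h | h⟩
    exacts [h, neighbor_symm h]
  · intro h
    refine ⟨fun e => ?_, Or.inl h⟩
    subst e
    have := height_neighbor h
    omega

theorem reachable_vStar (v : Vertex p) : (bruhatTits p).Reachable v (vStar p) := by
  induction h : height v generalizing v with
  | zero => rw [eq_vStar_of_height_eq_zero h]
  | succ n ih =>
    obtain ⟨w, hw, hh⟩ := exists_lower_neighbor (v := v) (by omega)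
    exact (bruhatTits_adj.2 hw).reachable.trans (ih w (by omega))

theorem bruhatTits_connected : (bruhatTits p).Connected :=
  { preconnected := fun v w => (reachable_vStar v).trans (reachable_vStar w).symm
    nonempty := ⟨vStar p⟩ }

theorem depth_eq_height (v : Vertex p) : depth v = height v := by
  apply le_antisymm
  · induction h : height v generalizing v with
    | zero => rw [eq_vStar_of_height_eq_zero h, depth, SimpleGraph.dist_self]
    | succ n ih =>
      obtain ⟨w, hw, hh⟩ := exists_lower_neighbor (v := v) (by omega)
      have h1 : (bruhatTits p).dist v w = 1 :=
        SimpleGraph.dist_eq_one_iff_adj.2 (bruhatTits_adj.2 hw)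
      have h2 := bruhatTits_connected.dist_triangle (u := v) (v := w) (w := vStar p)
      have h3 := ih w (by omega)
      rw [depth] at h3 ⊢
      omega
  · obtain ⟨W, hW⟩ := bruhatTits_connected.exists_walk_length_eq_dist v (vStar p)
    rw [depth, ← hW]
    have key : ∀ {v w : Vertex p} (W : (bruhatTits p).Walk v w),
        height v ≤ height w + W.length := by
      intro v w W
      induction W with
      | nil => simp
      | cons hadj _ ih =>
        have := height_neighbor (bruhatTits_adj.1 hadj)
        rw [SimpleGraph.Walk.length_cons]
        omega
    simpa [height_vStar] using key W

theorem dist_smul_smul (g : GL (Fin 2) ℚ_[p]) (v w : Vertex p) :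
    (bruhatTits p).dist (g • v) (g • w) = (bruhatTits p).dist v w := by
  have key : ∀ (g : GL (Fin 2) ℚ_[p]) (v w : Vertex p),
      (bruhatTits p).dist (g • v) (g • w) ≤ (bruhatTits p).dist v w := by
    intro g v w
    obtain ⟨W, hW⟩ := bruhatTits_connected.exists_walk_length_eq_dist v w
    let φ : bruhatTits p →g bruhatTits p :=
      ⟨fun v => g • v, fun h => bruhatTits_adj.2 ((bruhatTits_adj.1 h).smul g)⟩
    rw [← hW, ← W.length_map φ]
    exact SimpleGraph.dist_le _
  refine le_antisymm (key g v w) ?_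
  simpa using key g⁻¹ (g • v) (g • w)

theorem depth_inv_smul (g : GL (Fin 2) ℚ_[p]) : depth (g⁻¹ • vStar p) = depth (g • vStar p) := by
  rw [depth, ← dist_smul_smul g, smul_inv_smul, SimpleGraph.dist_comm, depth]

/-- A matrix whose determinant has valuation `m` is integral if and only if it moves `v_*` by at
most `m`. -/
theorem entryNorm_le_one_iff_depth_le {g : GL (Fin 2) ℚ_[p]} {m : ℕ}
    (hm : ‖g.1.det‖ = ((p : ℝ) ^ m)⁻¹) : entryNorm g.1 ≤ 1 ↔ depth (g • vStar p) ≤ m := by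
  have h := spread_eq_pow_height g
  have hp : (0 : ℝ) < (p : ℝ) ^ m := pow_pos (zero_lt_one.trans padic_one_lt_p) m
  rw [spread, hm, div_inv_eq_mul] at h
  rw [depth_eq_height, ← pow_le_pow_iff_right₀ (padic_one_lt_p (p := p)), ← h,
    mul_le_iff_le_one_left hp, sq_le_one_iff₀ (entryNorm_nonneg _)]

theorem exists_depth_smul_vStar_eq (g : GL (Fin 2) ℚ_[p]) :
    ∃ k : ℤ, (depth (g • vStar p) : ℤ) = 2 * k + g.1.det.valuation := by
  have h := spread_eq_pow_height g
  obtain ⟨i, j, hij⟩ := exists_norm_eq_entryNorm g.1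
  have hne : g.1 i j ≠ 0 := norm_ne_zero_iff.1 (by rw [← hij]; exact (entryNorm_pos g).ne')
  have hp : (p : ℝ) ≠ 0 := (zero_lt_one.trans padic_one_lt_p).ne'
  rw [spread, hij, Padic.norm_eq_zpow_neg_valuation hne,
    Padic.norm_eq_zpow_neg_valuation (det_ne_zero_GL g), ← zpow_natCast, ← zpow_natCast,
    ← zpow_mul, ← zpow_sub₀ hp] at h
  have := zpow_right_injective₀ (zero_lt_one.trans padic_one_lt_p)
    (padic_one_lt_p (p := p)).ne' h
  refine ⟨-(g.1 i j).valuation, ?_⟩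
  rw [depth_eq_height]
  push_cast at this
  omega

/-- `SL₂(ℚ_p)` preserves the parity of vertices. -/
theorem even_depth_smul_iff {g : GL (Fin 2) ℚ_[p]} (hg : g.1.det = 1) (v : Vertex p) :
    Even (depth (g • v)) ↔ Even (depth v) := by
  obtain ⟨h, rfl⟩ := exists_smul_vStar v
  obtain ⟨k, hk⟩ := exists_depth_smul_vStar_eq h
  obtain ⟨l, hl⟩ := exists_depth_smul_vStar_eq (g * h)
  rw [Units.val_mul, Matrix.det_mul, hg, one_mul] at hl
  rw [← mul_smul, Nat.even_iff, Nat.even_iff]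
  omega

theorem depth_vStar : depth (vStar p) = 0 := SimpleGraph.dist_self

theorem depth_neighbor {v w : Vertex p} (h : Neighbor v w) :
    depth v = depth w + 1 ∨ depth w = depth v + 1 := by
  rw [depth_eq_height, depth_eq_height]
  exact height_neighbor h

theorem depth_vHat : depth (vHat p) = 1 := by
  have := depth_neighbor (neighbor_vStar_vHat (p := p))
  rw [depth_vStar] at this
  omega

theorem eq_vStar_of_depth_eq_zero {v : Vertex p} (h : depth v = 0) : v = vStar p :=
  eq_vStar_of_height_eq_zero (depth_eq_height v ▸ h)

/-- The neighbor of `v ≠ v_*` on the path to `v_*`. -/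
def parent (v : Vertex p) : Vertex p :=
  if h : height v ≠ 0 then (exists_lower_neighbor h).choose else v

theorem parent_spec {v : Vertex p} (h : depth v ≠ 0) :
    Neighbor (parent v) v ∧ depth v = depth (parent v) + 1 := by
  rw [depth_eq_height] at h
  have := (exists_lower_neighbor h).choose_spec
  rw [parent, dif_pos h, depth_eq_height, depth_eq_height]
  exact ⟨neighbor_symm this.1, this.2⟩

theorem eq_parent {v w : Vertex p} (h : Neighbor w v) (hd : depth v = depth w + 1) :
    w = parent v := by
  have hs := parent_spec (v := v) (by omega)
  refine lower_neighbor_unique (neighbor_symm h) (neighbor_symm hs.1) ?_ ?_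
  · rw [← depth_eq_height, ← depth_eq_height]
    omega
  · rw [← depth_eq_height, ← depth_eq_height]
    omega

end Distance

/-! ### Reduced norm, reduced trace and orders -/

section Orders

variable {a b : ℚ}

theorem add_star_eq (x : QAlg a b) : x + star x = algebraMap ℚ (QAlg a b) (2 * x.re) := by
  ext <;> simp [QuaternionAlgebra.algebraMap_eq]
  ring

theorem isIntegral_of_mem_order {R : Subring (QAlg a b)} (hR : IsOrder R) {x : QAlg a b}
    (hx : x ∈ R) : IsIntegral ℤ x :=
  IsIntegral.of_mem_of_fg (subalgebraOfSubring R) hR.1 x hx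

theorem isIntegral_star {x : QAlg a b} (hx : IsIntegral ℤ x) : IsIntegral ℤ (star x) := by
  obtain ⟨f, hf, h0⟩ := hx
  refine ⟨f, hf, ?_⟩
  rw [← Polynomial.aeval_def] at h0 ⊢
  have : Polynomial.aeval (star x) f = star (Polynomial.aeval x f) := by
    rw [Polynomial.aeval_eq_sum_range, Polynomial.aeval_eq_sum_range, star_sum]
    simp [star_pow, (Int.cast_commute _ _).eq]
  rw [this, h0, star_zero]

/-- The reduced trace of an element of an order is an integer. -/
theorem exists_int_add_star {R : Subring (QAlg a b)} (hR : IsOrder R) {x : QAlg a b}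
    (hx : x ∈ R) : ∃ n : ℤ, x + star x = n := by
  have h1 := isIntegral_of_mem_order hR hx
  have h2 := isIntegral_star h1
  -- the two commuting elements `x`, `star x` lie in the commutative algebra `ℚ[x]`
  let S := Algebra.adjoin ℚ {x}
  have : IsMulCommutative S := Algebra.isMulCommutative_adjoin ℚ (by
    rintro _ rfl _ rfl
    rfl)
  have hxS : x ∈ S := Algebra.self_mem_adjoin_singleton ℚ x
  have hstar : star x = algebraMap ℚ (QAlg a b) (2 * x.re) - x := by
    rw [← add_star_eq]
    abel
  have hsS : star x ∈ S := hstar ▸ S.sub_mem (S.algebraMap_mem _) hxS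
  have hinj : Function.Injective (S.val.restrictScalars ℤ) := Subtype.val_injective
  have h1' : IsIntegral ℤ (⟨x, hxS⟩ : S) := (isIntegral_algHom_iff _ hinj).1 h1
  have h2' : IsIntegral ℤ (⟨star x, hsS⟩ : S) := (isIntegral_algHom_iff _ hinj).1 h2
  have h3 := (h1'.add h2').map (S.val.restrictScalars ℤ)
  have h4 : IsIntegral ℤ (algebraMap ℚ (QAlg a b) (2 * x.re)) := by
    rw [← add_star_eq]
    exact h3
  have h5 : IsIntegral ℤ (2 * x.re) :=
    (isIntegral_algHom_iff ((Algebra.ofId ℚ (QAlg a b)).restrictScalars ℤ)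
      (algebraMap ℚ (QAlg a b)).injective).1 h4
  obtain ⟨n, hn⟩ := IsIntegrallyClosed.isIntegral_iff.1 h5
  refine ⟨n, ?_⟩
  rw [add_star_eq, ← hn]
  simp

theorem star_mem_of_isOrder {R : Subring (QAlg a b)} (hR : IsOrder R) {x : QAlg a b}
    (hx : x ∈ R) : star x ∈ R := by
  obtain ⟨n, hn⟩ := exists_int_add_star hR hx
  have : star x = n - x := by rw [← hn]; abel
  rw [this]
  exact R.sub_mem (intCast_mem R n) hx

theorem le_invertP {p : ℕ} {R : Subring (QAlg a b)} : R ≤ invertP p R :=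
  fun x hx => ⟨0, by simpa using hx⟩

theorem star_mem_invertP {p : ℕ} {R : Subring (QAlg a b)} (hR : IsOrder R) {x : QAlg a b}
    (hx : x ∈ invertP p R) : star x ∈ invertP p R := by
  obtain ⟨k, hk⟩ := hx
  refine ⟨k, ?_⟩
  have := star_mem_of_isOrder hR hk
  rwa [star_mul, star_pow, star_natCast, ← ((Nat.cast_commute p (star x)).pow_left k)] at this

theorem inv_val_eq_star {u : (QAlg a b)ˣ} (hu : nrd (u : QAlg a b) = 1) :
    ((u⁻¹ : (QAlg a b)ˣ) : QAlg a b) = star (u : QAlg a b) := by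
  have h : (u : QAlg a b) * star (u : QAlg a b) = 1 := by rw [mul_star_eq_nrd, hu, map_one]
  rw [Units.inv_eq_of_mul_eq_one_right h]

theorem mem_normOneUnits_of_star {R : Subring (QAlg a b)} (hR : ∀ x ∈ R, star x ∈ R)
    {u : (QAlg a b)ˣ} (hu : (u : QAlg a b) ∈ R) (hn : nrd (u : QAlg a b) = 1) :
    u ∈ normOneUnits R :=
  ⟨hu, inv_val_eq_star hn ▸ hR _ hu, hn⟩

theorem nrd_algebraMap (q : ℚ) : nrd (algebraMap ℚ (QAlg a b) q) = q ^ 2 := by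
  simp [nrd, QuaternionAlgebra.algebraMap_eq]

end Orders

section Splittings

variable {a b : ℚ} {p : ℕ} [Fact p.Prime]

/-- A splitting, restricted to the quaternion algebra, as a homomorphism of `ℚ`-algebras. -/
def Splitting.ratHom (f : Splitting a b p) : QAlg a b →ₐ[ℚ] Matrix (Fin 2) (Fin 2) ℚ_[p] :=
  ((AlgEquiv.toAlgHom f).restrictScalars ℚ).comp Algebra.TensorProduct.includeRight

theorem Splitting.ratHom_apply (f : Splitting a b p) (x : QAlg a b) :
    f.ratHom x = f.toHom x := rfl

theorem Splitting.toHom_algebraMap (f : Splitting a b p) (q : ℚ) :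
    f.toHom (algebraMap ℚ (QAlg a b) q) = algebraMap ℚ_[p] _ (q : ℚ_[p]) := by
  rw [← ratHom_apply, AlgHom.commutes]
  rfl

theorem trace_eq_zero_of_anticomm {u v : Matrix (Fin 2) (Fin 2) ℚ_[p]} {c : ℚ_[p]} (hc : c ≠ 0)
    (huv : u * v = -(v * u)) (hv : v * v = algebraMap ℚ_[p] _ c) : u.trace = 0 := by
  have h1 : (u * v * v).trace = c * u.trace := by
    rw [mul_assoc, hv, ← Algebra.commutes, ← Algebra.smul_def, Matrix.trace_smul, smul_eq_mul]
  have h2 : (u * v * v).trace = -(u * v * v).trace := by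
    conv_lhs => rw [Matrix.trace_mul_comm, ← mul_assoc, ← neg_neg (v * u), ← huv, neg_mul,
      Matrix.trace_neg]
  have h3 : (u * v * v).trace = 0 := self_eq_neg.1 h2
  rw [h1] at h3
  exact (mul_eq_zero.1 h3).resolve_left hc

/-- The trace of `ι_p(x)` is the reduced trace of `x`: each of `i`, `j`, `ij` anticommutes with
another one of them, and therefore has trace `0`. -/
theorem trace_toHom (ha : a ≠ 0) (hb : b ≠ 0) (f : Splitting a b p) (x : QAlg a b) :
    (f.toHom x).trace = ((2 * x.re : ℚ) : ℚ_[p]) := by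
  have ha' : (a : ℚ_[p]) ≠ 0 := Rat.cast_ne_zero.2 ha
  have hb' : (b : ℚ_[p]) ≠ 0 := Rat.cast_ne_zero.2 hb
  have hii : f.ratHom ⟨0, 1, 0, 0⟩ * f.ratHom ⟨0, 1, 0, 0⟩ = algebraMap ℚ_[p] _ (a : ℚ_[p]) := by
    rw [← map_mul, ← f.toHom_algebraMap, ← f.ratHom_apply]
    congr 1
    ext <;> simp [QuaternionAlgebra.algebraMap_eq]
  have hjj : f.ratHom ⟨0, 0, 1, 0⟩ * f.ratHom ⟨0, 0, 1, 0⟩ = algebraMap ℚ_[p] _ (b : ℚ_[p]) := by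
    rw [← map_mul, ← f.toHom_algebraMap, ← f.ratHom_apply]
    congr 1
    ext <;> simp [QuaternionAlgebra.algebraMap_eq]
  have hi : (f.ratHom ⟨0, 1, 0, 0⟩).trace = 0 := by
    refine trace_eq_zero_of_anticomm hb' ?_ hjj
    rw [← map_mul, ← map_mul, ← map_neg]
    congr 1
    ext <;> simp
  have hj : (f.ratHom ⟨0, 0, 1, 0⟩).trace = 0 := by
    refine trace_eq_zero_of_anticomm ha' ?_ hii
    rw [← map_mul, ← map_mul, ← map_neg]
    congr 1
    ext <;> simp
  have hk : (f.ratHom ⟨0, 0, 0, 1⟩).trace = 0 := by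
    refine trace_eq_zero_of_anticomm ha' ?_ hii
    rw [← map_mul, ← map_mul, ← map_neg]
    congr 1
    ext <;> simp
  have hx : x = x.re • (1 : QAlg a b) + x.imI • ⟨0, 1, 0, 0⟩ + x.imJ • ⟨0, 0, 1, 0⟩ +
      x.imK • ⟨0, 0, 0, 1⟩ := by
    ext <;> simp
  rw [← f.ratHom_apply]
  conv_lhs => rw [hx]
  simp only [map_add, map_smul, Matrix.trace_add, Matrix.trace_smul, hi, hj, hk, map_one,
    smul_zero, add_zero, Matrix.trace_one, Fintype.card_fin]
  rw [Rat.smul_def]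
  push_cast
  ring

/-- The determinant of `ι_p(x)` is the reduced norm of `x`. -/
theorem det_toHom (ha : a ≠ 0) (hb : b ≠ 0) (f : Splitting a b p) (x : QAlg a b) :
    (f.toHom x).det = ((nrd x : ℚ) : ℚ_[p]) := by
  have h1 : f.toHom (star x) = (f.toHom x).adjugate := by
    have hs : star x = algebraMap ℚ (QAlg a b) (2 * x.re) - x := by
      rw [← add_star_eq]
      abel
    rw [← f.ratHom_apply, hs, map_sub, f.ratHom_apply, f.ratHom_apply, f.toHom_algebraMap,
      ← trace_toHom ha hb f x, Matrix.adjugate_fin_two]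
    ext i j
    fin_cases i <;> fin_cases j <;>
      simp [Matrix.trace_fin_two, Matrix.algebraMap_matrix_apply]
  have h2 : f.toHom (x * star x) = algebraMap ℚ_[p] _ ((nrd x : ℚ) : ℚ_[p]) := by
    rw [mul_star_eq_nrd, f.toHom_algebraMap]
  rw [map_mul, h1, Matrix.mul_adjugate] at h2
  have := congrFun (congrFun h2 0) 0
  simpa [Matrix.algebraMap_matrix_apply] using this

theorem toGL_val (f : Splitting a b p) (u : (QAlg a b)ˣ) :
    (f.toGL u).1 = f.toHom (u : QAlg a b) := rfl

theorem toGL_algebraMap_smul (f : Splitting a b p) {u : (QAlg a b)ˣ} {q : ℚ}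
    (hu : (u : QAlg a b) = algebraMap ℚ (QAlg a b) q) (v : Vertex p) : f.toGL u • v = v := by
  have hq : (q : ℚ_[p]) ≠ 0 := by
    rw [Rat.cast_ne_zero]
    rintro rfl
    exact u.ne_zero (by rw [hu, map_zero])
  have : f.toGL u = scalarGL (Units.mk0 _ hq) := by
    refine Units.ext ?_
    rw [toGL_val, hu, f.toHom_algebraMap]
    rfl
  rw [this, scalarGL_smul_vertex]

theorem mem_localCompletion {f : Splitting a b p} {R : Subring (QAlg a b)} {x : QAlg a b}
    (hx : x ∈ R) : f.toHom x ∈ localCompletion f R :=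
  Submodule.subset_span ⟨x, hx, rfl⟩

/-- An element of `R ⊗ ℤ[1/p]` whose image lies in `R ⊗ ℤ_p` lies in `R`: its coordinates with
respect to a basis of `R` lie in `ℤ[1/p] ∩ ℤ_p = ℤ`. -/
theorem mem_of_mem_invertP {f : Splitting a b p} {R : Subring (QAlg a b)} (hR : IsOrder R)
    {x : QAlg a b} (hx : x ∈ invertP p R) (hf : f.toHom x ∈ localCompletion f R) : x ∈ R := by
  let M : Submodule ℤ (QAlg a b) := AddSubgroup.toIntSubmodule R.toAddSubgroup
  have : M.IsLattice ℚ := ⟨hR.1, hR.2⟩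
  let β := Module.Free.chooseBasis ℤ M
  let B := β.extendOfIsLattice ℚ
  have hB : ∀ i, B i = (β i : QAlg a b) := fun i => by simp [B]
  let B' := (B.baseChange ℚ_[p]).map f.toLinearEquiv
  have hB' : ∀ i, B' i = f.toHom (B i) := fun i => by
    simp [B', Splitting.toHom_apply]
  have hrepr : ∀ y : QAlg a b, ∀ i, B'.repr (f.toHom y) i = ((B.repr y i : ℚ) : ℚ_[p]) := by
    intro y i
    simp [B', Splitting.toHom_apply]
  have hint : ∀ y ∈ R, ∀ i, ∃ n : ℤ, B.repr y i = n := by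
    intro y hy i
    let y' : M := ⟨y, hy⟩
    have h : y = ∑ j, ((β.repr y' j : ℤ) : ℚ) • B j := by
      have h1 := congrArg Subtype.val (β.sum_repr y')
      rw [Submodule.coe_sum] at h1
      refine h1.symm.trans (Finset.sum_congr rfl fun j _ => ?_)
      rw [hB, Int.cast_smul_eq_zsmul]
      rfl
    refine ⟨β.repr y' i, ?_⟩
    rw [h, B.repr_sum_self]
  have hloc : ∀ A ∈ localCompletion f R, ∀ i, ‖B'.repr A i‖ ≤ 1 := by
    intro A hA i
    induction hA using Submodule.span_induction with
    | mem A hA =>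
      obtain ⟨y, hy, rfl⟩ := hA
      obtain ⟨n, hn⟩ := hint y hy i
      rw [hrepr, hn, Rat.cast_intCast]
      exact Padic.norm_int_le_one n
    | zero => simp
    | add A A' _ _ h h' =>
      rw [map_add, Finsupp.add_apply]
      exact padic_norm_add_le_of_le h h'
    | smul c A _ h =>
      have : c • A = (c : ℚ_[p]) • A := rfl
      rw [this, map_smul, Finsupp.smul_apply, smul_eq_mul]
      exact padic_norm_mul_le_one c.2 h
  have hcoord : ∀ i, ∃ n : ℤ, B.repr x i = n := by
    intro i
    obtain ⟨k, hk⟩ := hx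
    obtain ⟨n, hn⟩ := hint _ hk i
    have h1 : (p : QAlg a b) ^ k * x = ((p : ℚ) ^ k) • x := by
      rw [Algebra.smul_def, map_pow, map_natCast]
    rw [h1, map_smul, Finsupp.smul_apply, smul_eq_mul] at hn
    have h2 := hloc _ hf i
    rw [hrepr] at h2
    have hdvd : (p : ℤ) ^ k ∣ n := by
      rw [← Padic.norm_int_le_pow_iff_dvd, ← Rat.cast_intCast, ← hn]
      push_cast
      rw [norm_mul, ← Padic.norm_p_pow]
      exact mul_le_of_le_one_right (norm_nonneg _) h2
    obtain ⟨m, rfl⟩ := hdvd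
    refine ⟨m, ?_⟩
    have hp : (p : ℚ) ^ k ≠ 0 := pow_ne_zero _ (Nat.cast_ne_zero.2 (Fact.out : p.Prime).ne_zero)
    push_cast at hn
    exact mul_left_cancel₀ hp hn
  rw [← B.sum_repr x]
  refine R.sum_mem fun i _ => ?_
  obtain ⟨n, hn⟩ := hcoord i
  rw [hn, hB, Int.cast_smul_eq_zsmul]
  exact R.zsmul_mem (β i).2 n

end Splittings

/-! ### Existence and uniqueness of the radial system -/

section Radial

variable {a b : ℚ} {p : ℕ} [Fact p.Prime]

/-- The local input of the construction: `γ` and `γt` are families in a group `Γ` that preserves the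
parity of vertices; `γ` fixes `v_*` and its inverses move `v̂_*` to each neighbor of
`v_*` exactly once, and `γt` fixes `v̂_*` and its inverses move `v_*` to each neighbor of `v̂_*`
exactly once. -/
structure IsLocallySimplyTransitive (f : Splitting a b p) (Γ : Subgroup (QAlg a b)ˣ)
    (γ γt : Fin (p + 1) → (QAlg a b)ˣ) : Prop where
  mem : ∀ i, γ i ∈ Γ
  mem_tilde : ∀ i, γt i ∈ Γ
  zero : γ 0 = 1
  zero_tilde : γt 0 = 1
  even_iff : ∀ g ∈ Γ, ∀ v : Vertex p, Even (depth (f.toGL g • v)) ↔ Even (depth v)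
  smul_vStar : ∀ i, f.toGL (γ i) • vStar p = vStar p
  smul_vHat : ∀ i, f.toGL (γt i) • vHat p = vHat p
  neighbor_vStar : ∀ w : Vertex p, Neighbor (vStar p) w → ∃! i, (f.toGL (γ i))⁻¹ • vHat p = w
  neighbor_vHat : ∀ w : Vertex p, Neighbor (vHat p) w → ∃! i, (f.toGL (γt i))⁻¹ • vStar p = w

variable (p) in
/-- The vertex of `e_*` that has the parity of `n`. -/
def baseVertex (n : ℕ) : Vertex p := if Even n then vStar p else vHat p

/-- The family through which the radial system passes from depth `n - 1` to depth `n`. -/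
def stepFamily {q : ℕ} (γ γt : Fin (q + 1) → (QAlg a b)ˣ) (n : ℕ) :
    Fin (q + 1) → (QAlg a b)ˣ :=
  if Even n then γt else γ

variable {f : Splitting a b p} {Γ : Subgroup (QAlg a b)ˣ} {γ γt : Fin (p + 1) → (QAlg a b)ˣ}

theorem baseVertex_even {n : ℕ} (h : Even n) : baseVertex p n = vStar p := if_pos h

theorem baseVertex_odd {n : ℕ} (h : ¬ Even n) : baseVertex p n = vHat p := if_neg h

theorem stepFamily_even {q : ℕ} {γ γt : Fin (q + 1) → (QAlg a b)ˣ} {n : ℕ} (h : Even n) :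
    stepFamily γ γt n = γt := if_pos h

theorem stepFamily_odd {q : ℕ} {γ γt : Fin (q + 1) → (QAlg a b)ˣ} {n : ℕ} (h : ¬ Even n) :
    stepFamily γ γt n = γ := if_neg h

theorem even_depth_neighbor {v w : Vertex p} (h : Neighbor v w) :
    Even (depth w) ↔ ¬ Even (depth v) := by
  rcases depth_neighbor h with h | h <;> rw [h, Nat.even_add_one]
  rw [not_not]

namespace IsLocallySimplyTransitive

theorem stepFamily_mem (H : IsLocallySimplyTransitive f Γ γ γt) (n : ℕ) (i : Fin (p + 1)) :
    stepFamily γ γt n i ∈ Γ := by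
  by_cases h : Even n
  · rw [stepFamily_even h]
    exact H.mem_tilde i
  · rw [stepFamily_odd h]
    exact H.mem i

/-- A step does not move the vertex from which it starts. -/
theorem stepFamily_inv_smul (H : IsLocallySimplyTransitive f Γ γ γt) {v w : Vertex p}
    (h : Neighbor w v) {g : (QAlg a b)ˣ} (hg : (f.toGL g)⁻¹ • baseVertex p (depth w) = w)
    (i : Fin (p + 1)) :
    (f.toGL (stepFamily γ γt (depth v) i * g))⁻¹ • baseVertex p (depth w) = w := by
  rw [map_mul, mul_inv_rev, mul_smul]
  have hpar := even_depth_neighbor h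
  have : (f.toGL (stepFamily γ γt (depth v) i))⁻¹ • baseVertex p (depth w) =
      baseVertex p (depth w) := by
    rw [inv_smul_eq_iff, eq_comm]
    by_cases hv : Even (depth v)
    · rw [stepFamily_even hv, baseVertex_odd (hpar.1 hv)]
      exact H.smul_vHat i
    · rw [stepFamily_odd hv, baseVertex_even (not_not.1 fun h => hv (hpar.2 h))]
      exact H.smul_vStar i
  rw [this, hg]

/-- From a vertex, there is exactly one step to each neighbor. -/
theorem existsUnique_step (H : IsLocallySimplyTransitive f Γ γ γt) {v w : Vertex p}
    (h : Neighbor w v) {g : (QAlg a b)ˣ} (hg : (f.toGL g)⁻¹ • baseVertex p (depth w) = w) :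
    ∃! i, (f.toGL (stepFamily γ γt (depth v) i * g))⁻¹ • baseVertex p (depth v) = v := by
  have hn := h.smul (f.toGL g)
  have hw : f.toGL g • w = baseVertex p (depth w) := by rw [← hg, smul_inv_smul, hg]
  rw [hw] at hn
  have hpar := even_depth_neighbor h
  simp only [map_mul, mul_inv_rev, mul_smul]
  simp only [inv_smul_eq_iff (g := f.toGL g)]
  by_cases hv : Even (depth v)
  · rw [stepFamily_even hv, baseVertex_even hv]
    rw [baseVertex_odd (hpar.1 hv)] at hn
    exact H.neighbor_vHat _ hn
  · rw [stepFamily_odd hv, baseVertex_odd hv]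
    rw [baseVertex_even (not_not.1 fun h => hv (hpar.2 h))] at hn
    exact H.neighbor_vStar _ hn

end IsLocallySimplyTransitive

open Classical in
variable (f γ γt) in
/-- The elements `γ_v` for `v` at depth `n`: the step from the parent of `v` to `v`, times the
element of the parent. -/
def radialAux : ℕ → Vertex p → (QAlg a b)ˣ
  | 0, _ => 1
  | n + 1, v =>
    if h : ∃ i, (f.toGL (stepFamily γ γt (n + 1) i * radialAux n (parent v)))⁻¹ •
        baseVertex p (n + 1) = v then
      stepFamily γ γt (n + 1) h.choose * radialAux n (parent v)
    else 1

variable (f γ γt) in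
/-- The elements `γ_v` of the radial system. -/
def radialVertex (v : Vertex p) : (QAlg a b)ˣ := radialAux f γ γt (depth v) v

variable (f γ γt) in
/-- The elements `γ_e` of the radial system: `γ_e = γ_v` for the end `v` of `e` farther from
`v_*`. -/
def radialEdge (e : EvenEdge p) : (QAlg a b)ˣ :=
  if depth e.1.src < depth e.1.tgt then radialVertex f γ γt e.1.tgt
  else radialVertex f γ γt e.1.src

theorem radialVertex_vStar : radialVertex f γ γt (vStar p) = 1 := by
  rw [radialVertex, depth_vStar, radialAux]

namespace IsLocallySimplyTransitive

/-- `γ_v` moves `v` to the vertex of `e_*` of the same parity, and arises from the element of the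
parent of `v` by one step. -/
theorem radialVertex_spec (H : IsLocallySimplyTransitive f Γ γ γt) (v : Vertex p) :
    radialVertex f γ γt v ∈ Γ ∧
      (f.toGL (radialVertex f γ γt v))⁻¹ • baseVertex p (depth v) = v ∧
      (depth v ≠ 0 → ∃ i, radialVertex f γ γt v =
        stepFamily γ γt (depth v) i * radialVertex f γ γt (parent v)) := by
  induction h : depth v generalizing v with
  | zero =>
    have hv := eq_vStar_of_depth_eq_zero h
    subst hv
    rw [radialVertex_vStar, map_one, inv_one, one_smul, baseVertex_even Even.zero]
    exact ⟨Γ.one_mem, rfl, fun h => absurd rfl h⟩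
  | succ n ih =>
    have hpar := parent_spec (v := v) (by omega)
    have hd : depth (parent v) = n := by omega
    obtain ⟨h1, h2, -⟩ := ih (parent v) hd
    obtain ⟨i, hi, -⟩ := H.existsUnique_step hpar.1 (hd ▸ h2)
    rw [h] at hi
    have hex : ∃ i, (f.toGL (stepFamily γ γt (n + 1) i * radialAux f γ γt n (parent v)))⁻¹ •
        baseVertex p (n + 1) = v := by
      rw [radialVertex, hd] at hi
      exact ⟨i, hi⟩
    have hrec : radialVertex f γ γt v =
        stepFamily γ γt (n + 1) hex.choose * radialVertex f γ γt (parent v) := by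
      rw [radialVertex, h, radialAux, dif_pos hex, radialVertex, hd]
    have hspec := hex.choose_spec
    refine ⟨?_, ?_, fun _ => ⟨_, hrec⟩⟩
    · rw [hrec]
      exact Γ.mul_mem (H.stepFamily_mem _ _) h1
    · rw [hrec, radialVertex, hd]
      exact hspec

theorem radialVertex_eq_step (H : IsLocallySimplyTransitive f Γ γ γt) {v w : Vertex p}
    (h : Neighbor w v) (hd : depth v = depth w + 1) :
    ∃ i, radialVertex f γ γt v = stepFamily γ γt (depth v) i * radialVertex f γ γt w := by
  rw [eq_parent h hd]
  exact (H.radialVertex_spec v).2.2 (by omega)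

theorem radialEdge_spec (H : IsLocallySimplyTransitive f Γ γ γt) (e : EvenEdge p) :
    radialEdge f γ γt e ∈ Γ ∧ (f.toGL (radialEdge f γ γt e))⁻¹ • eStar p = e.1 ∧
      (∃ i, radialEdge f γ γt e = γ i * radialVertex f γ γt e.1.src) ∧
      ∃ i, radialEdge f γ γt e = γt i * radialVertex f γ γt e.1.tgt := by
  have hev : Even (depth e.1.src) := e.2
  have hodd : ¬ Even (depth e.1.tgt) := fun h => (even_depth_neighbor e.1.neighbor).1 h hev
  obtain ⟨hs1, hs2, -⟩ := H.radialVertex_spec e.1.src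
  obtain ⟨ht1, ht2, -⟩ := H.radialVertex_spec e.1.tgt
  rcases depth_neighbor e.1.neighbor with hd | hd
  · have hE : radialEdge f γ γt e = radialVertex f γ γt e.1.src := if_neg (by omega)
    obtain ⟨i, hi⟩ := H.radialVertex_eq_step (neighbor_symm e.1.neighbor) hd
    have h := H.stepFamily_inv_smul (neighbor_symm e.1.neighbor) ht2 i
    rw [← hi, baseVertex_odd hodd] at h
    rw [baseVertex_even hev] at hs2
    rw [stepFamily_even hev] at hi
    rw [hE]
    exact ⟨hs1, Edge.ext hs2 h, ⟨0, by rw [H.zero, one_mul]⟩, ⟨i, hi⟩⟩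
  · have hE : radialEdge f γ γt e = radialVertex f γ γt e.1.tgt := if_pos (by omega)
    obtain ⟨i, hi⟩ := H.radialVertex_eq_step e.1.neighbor hd
    have h := H.stepFamily_inv_smul e.1.neighbor hs2 i
    rw [← hi, baseVertex_even hev] at h
    rw [baseVertex_odd hodd] at ht2
    rw [stepFamily_odd hodd] at hi
    rw [hE]
    exact ⟨ht1, Edge.ext h ht2, ⟨i, hi⟩, ⟨0, by rw [H.zero_tilde, one_mul]⟩⟩

theorem mem_even_edge (H : IsLocallySimplyTransitive f Γ γ γt) {g : (QAlg a b)ˣ} (hg : g ∈ Γ) :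
    Even (depth ((f.toGL g)⁻¹ • eStar p).src) := by
  change Even (depth ((f.toGL g)⁻¹ • vStar p))
  rw [← H.even_iff g hg, smul_inv_smul, depth_vStar]
  exact Even.zero

/-- The element `γ_e` is determined by its coset and by its source. -/
theorem radialEdge_eq_of_src (H : IsLocallySimplyTransitive f Γ γ γt) (e : EvenEdge p)
    {i : Fin (p + 1)}
    (h : (f.toGL (γ i * radialVertex f γ γt e.1.src))⁻¹ • vHat p = e.1.tgt) :
    radialEdge f γ γt e = γ i * radialVertex f γ γt e.1.src := by
  have hev : Even (depth e.1.src) := e.2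
  have hodd : ¬ Even (depth e.1.tgt) := fun h => (even_depth_neighbor e.1.neighbor).1 h hev
  obtain ⟨-, h1, ⟨j, hj⟩, -⟩ := H.radialEdge_spec e
  have h2 := congrArg Edge.tgt h1
  change (f.toGL (radialEdge f γ γt e))⁻¹ • vHat p = _ at h2
  have hu := H.existsUnique_step e.1.neighbor (H.radialVertex_spec e.1.src).2.1
  rw [stepFamily_odd hodd, baseVertex_odd hodd] at hu
  rw [hj] at h2
  rw [hj, hu.unique h2 h]

/-- The element `γ_e` is determined by its coset and by its target. -/
theorem radialEdge_eq_of_tgt (H : IsLocallySimplyTransitive f Γ γ γt) (e : EvenEdge p)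
    {i : Fin (p + 1)}
    (h : (f.toGL (γt i * radialVertex f γ γt e.1.tgt))⁻¹ • vStar p = e.1.src) :
    radialEdge f γ γt e = γt i * radialVertex f γ γt e.1.tgt := by
  have hev : Even (depth e.1.src) := e.2
  obtain ⟨-, h1, -, ⟨j, hj⟩⟩ := H.radialEdge_spec e
  have h2 := congrArg Edge.src h1
  change (f.toGL (radialEdge f γ γt e))⁻¹ • vStar p = _ at h2
  have hu := H.existsUnique_step (neighbor_symm e.1.neighbor) (H.radialVertex_spec e.1.tgt).2.1
  rw [stepFamily_even hev, baseVertex_even hev] at hu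
  rw [hj] at h2
  rw [hj, hu.unique h2 h]

theorem isRadialSystem (H : IsLocallySimplyTransitive f Γ γ γt) :
    IsRadialSystem f Γ γ γt (radialEdge f γ γt) (radialVertex f γ γt) where
  edge_mem e := (H.radialEdge_spec e).1
  vertex_mem v := (H.radialVertex_spec v).1
  edge_rep e := (H.radialEdge_spec e).2.1
  vertex_rep v hv := by
    have := (H.radialVertex_spec v).2.1
    rwa [baseVertex_even hv] at this
  vStar_eq := radialVertex_vStar
  vHat_eq := by
    let e : EvenEdge p := ⟨eStar p, by
      change Even (depth (vStar p))
      rw [depth_vStar]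
      exact Even.zero⟩
    have hE : radialEdge f γ γt e = radialVertex f γ γt (vHat p) := if_pos (by
      change depth (vStar p) < depth (vHat p)
      rw [depth_vStar, depth_vHat]
      exact one_pos)
    have hs : radialVertex f γ γt e.1.src = 1 := radialVertex_vStar
    have := H.radialEdge_eq_of_src e (i := 0) (by
      rw [H.zero, hs, one_mul, map_one, inv_one, one_smul]
      rfl)
    rw [← hE, this, H.zero, hs, one_mul]
  outgoing v hv := by
    apply Set.eq_of_subset_of_subset
    · rintro _ ⟨e, rfl, rfl⟩
      obtain ⟨i, hi⟩ := (H.radialEdge_spec e).2.2.1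
      exact ⟨i, hi.symm⟩
    · rintro _ ⟨i, rfl⟩
      have hs : (f.toGL (γ i * radialVertex f γ γt v))⁻¹ • vStar p = v := by
        have := (H.radialVertex_spec v).2.1
        rw [baseVertex_even hv] at this
        rw [map_mul, mul_inv_rev, mul_smul, inv_smul_eq_iff.2 (H.smul_vStar i).symm, this]
      let e : EvenEdge p := ⟨(f.toGL (γ i * radialVertex f γ γt v))⁻¹ • eStar p,
        H.mem_even_edge (Γ.mul_mem (H.mem i) (H.radialVertex_spec v).1)⟩
      have hsrc : e.1.src = v := hs
      refine ⟨e, hsrc, ?_⟩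
      have := H.radialEdge_eq_of_src e (i := i) (by rw [hsrc]; rfl)
      rwa [hsrc] at this
  incoming v hv := by
    have hv' : ¬ Even (depth v) := Nat.not_even_iff_odd.2 hv
    apply Set.eq_of_subset_of_subset
    · rintro _ ⟨e, rfl, rfl⟩
      obtain ⟨i, hi⟩ := (H.radialEdge_spec e).2.2.2
      exact ⟨i, hi.symm⟩
    · rintro _ ⟨i, rfl⟩
      have ht : (f.toGL (γt i * radialVertex f γ γt v))⁻¹ • vHat p = v := by
        have := (H.radialVertex_spec v).2.1
        rw [baseVertex_odd hv'] at this
        rw [map_mul, mul_inv_rev, mul_smul, inv_smul_eq_iff.2 (H.smul_vHat i).symm, this]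
      let e : EvenEdge p := ⟨(f.toGL (γt i * radialVertex f γ γt v))⁻¹ • eStar p,
        H.mem_even_edge (Γ.mul_mem (H.mem_tilde i) (H.radialVertex_spec v).1)⟩
      have htgt : e.1.tgt = v := ht
      refine ⟨e, htgt, ?_⟩
      have := H.radialEdge_eq_of_tgt e (i := i) (by rw [htgt]; rfl)
      rwa [htgt] at this
  src_eq e h := (if_neg (by omega) : radialEdge f γ γt e = radialVertex f γ γt e.1.src).symm
  tgt_eq e h := (if_pos h : radialEdge f γ γt e = radialVertex f γ γt e.1.tgt).symm

theorem radialVertex_unique (H : IsLocallySimplyTransitive f Γ γ γt)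
    {γE : EvenEdge p → (QAlg a b)ˣ} {γV : Vertex p → (QAlg a b)ˣ}
    (h : IsRadialSystem f Γ γ γt γE γV) (v : Vertex p) : γV v = radialVertex f γ γt v := by
  induction hn : depth v generalizing v with
  | zero =>
    have hv := eq_vStar_of_depth_eq_zero hn
    subst hv
    rw [radialVertex_vStar, h.vStar_eq]
  | succ n ih =>
    have hpar := parent_spec (v := v) (by omega)
    have hw := ih (parent v) (by omega)
    have hpe := even_depth_neighbor hpar.1
    by_cases hv : Even (depth v)
    · let e : EvenEdge p := ⟨⟨v, parent v, neighbor_symm hpar.1⟩, hv⟩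
      have hlt : depth e.1.tgt < depth e.1.src := by
        change depth (parent v) < depth v
        omega
      have hE : radialEdge f γ γt e = radialVertex f γ γt v := if_neg (by omega)
      have hmem : γE e ∈ γE '' {e | e.1.tgt = parent v} := ⟨e, rfl, rfl⟩
      rw [h.incoming (parent v) (Nat.not_even_iff_odd.1 (hpe.1 hv)), hw] at hmem
      obtain ⟨i, hi⟩ := hmem
      have hrep := congrArg Edge.src (h.edge_rep e)
      rw [← hi] at hrep
      have := H.radialEdge_eq_of_tgt e hrep
      rw [← hE, this]
      exact (h.src_eq e hlt).trans hi.symm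
    · have hw' : Even (depth (parent v)) := not_not.1 fun h => hv (hpe.2 h)
      let e : EvenEdge p := ⟨⟨parent v, v, hpar.1⟩, hw'⟩
      have hlt : depth e.1.src < depth e.1.tgt := by
        change depth (parent v) < depth v
        omega
      have hE : radialEdge f γ γt e = radialVertex f γ γt v := if_pos hlt
      have hmem : γE e ∈ γE '' {e | e.1.src = parent v} := ⟨e, rfl, rfl⟩
      rw [h.outgoing (parent v) hw', hw] at hmem
      obtain ⟨i, hi⟩ := hmem
      have hrep := congrArg Edge.tgt (h.edge_rep e)
      rw [← hi] at hrep
      have := H.radialEdge_eq_of_src e hrep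
      rw [← hE, this]
      exact (h.tgt_eq e hlt).trans hi.symm

theorem isRadialSystem_iff (H : IsLocallySimplyTransitive f Γ γ γt)
    (γE : EvenEdge p → (QAlg a b)ˣ) (γV : Vertex p → (QAlg a b)ˣ) :
    IsRadialSystem f Γ γ γt γE γV ↔
      γE = radialEdge f γ γt ∧ γV = radialVertex f γ γt := by
  constructor
  · intro h
    have hV := H.radialVertex_unique h
    refine ⟨funext fun e => ?_, funext hV⟩
    rcases depth_neighbor e.1.neighbor with hd | hd
    · rw [← h.src_eq e (by omega), hV]
      exact (if_neg (by omega) : radialEdge f γ γt e = radialVertex f γ γt e.1.src).symm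
    · rw [← h.tgt_eq e (by omega), hV]
      exact (if_pos (by omega) : radialEdge f γ γt e = radialVertex f γ γt e.1.tgt).symm
  · rintro ⟨rfl, rfl⟩
    exact H.isRadialSystem

end IsLocallySimplyTransitive

end Radial

/-! ### The local data given by Eichler orders and an Atkin–Lehner element -/

section EichlerData

variable {a b : ℚ}

theorem mem_normOneUnits_invertP {p : ℕ} {R : Subring (QAlg a b)}
    (hR : IsOrder R) {u : (QAlg a b)ˣ}
    (hu : (u : QAlg a b) ∈ invertP p R) (hn : nrd (u : QAlg a b) = 1) :
    u ∈ normOneUnits (invertP p R) :=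
  mem_normOneUnits_of_star (fun _ => star_mem_invertP hR) hu hn

variable {p : ℕ} [Fact p.Prime]

theorem entryNorm_le_one_of_mem_localEichler {N : ℕ} {A : Matrix (Fin 2) (Fin 2) ℚ_[p]}
    (hA : A ∈ localEichler p N) : entryNorm A ≤ 1 :=
  entryNorm_le_iff.2 hA.1

theorem mem_localEichler_of_not_dvd {N : ℕ} (hN : ¬ p ∣ N) {A : Matrix (Fin 2) (Fin 2) ℚ_[p]}
    (hA : entryNorm A ≤ 1) : A ∈ localEichler p N := by
  refine ⟨entryNorm_le_iff.1 hA, ?_⟩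
  have h1 : ‖(N : ℚ_[p])‖ = 1 := by
    refine le_antisymm (padic_norm_natCast_le_one N) (not_lt.1 fun h => hN ?_)
    have : (p : ℤ) ∣ (N : ℤ) := Padic.norm_intCast_lt_one_iff.1 (by exact_mod_cast h)
    exact_mod_cast this
  rw [h1]
  exact entryNorm_le_iff.1 hA 1 0

theorem isIntegralGL_of_mem_localGamma0 {u : GL (Fin 2) ℚ_[p]} (hu : u.1 ∈ localGamma0 p) :
    IsIntegralGL u :=
  ⟨entryNorm_le_one_of_mem_localEichler hu.1, by rw [hu.2, norm_one]⟩

/-- `Γ₀^loc(p)` fixes `v̂_*`. -/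
theorem smul_vHat_of_mem_localGamma0 {u : GL (Fin 2) ℚ_[p]} (hu : u.1 ∈ localGamma0 p) :
    u • vHat p = vHat p := by
  have key : ∀ A : Matrix (Fin 2) (Fin 2) ℚ_[p], A ∈ localEichler p p →
      ∀ x ∈ (diagLattice (p : ℚ_[p]) padic_p_ne_zero).carrier,
        A *ᵥ x ∈ (diagLattice (p : ℚ_[p]) padic_p_ne_zero).carrier := by
    rintro A ⟨hA, hA'⟩ x hx
    rw [mem_diagLattice] at hx ⊢
    rw [mulVec_two, mulVec_two]
    have hp : ‖(p : ℚ_[p])‖ ≤ 1 := Padic.norm_p_lt_one.le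
    refine ⟨padic_norm_add_le_of_le (padic_norm_mul_le_one (hA _ _) hx.1)
      (padic_norm_mul_le_one (hA _ _) (hx.2.trans hp)), padic_norm_add_le_of_le ?_ ?_⟩
    · rw [norm_mul]
      exact (mul_le_of_le_one_right (norm_nonneg _) hx.1).trans hA'
    · rw [norm_mul]
      exact (mul_le_of_le_one_left (norm_nonneg _) (hA _ _)).trans hx.2
  have hinv : (u⁻¹).1 ∈ localEichler p p := by
    rw [GL_inv_apply, hu.2, inv_one, one_smul]
    obtain ⟨⟨h, h'⟩, -⟩ := hu
    refine ⟨fun i j => ?_, by simpa using h'⟩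
    fin_cases i <;> fin_cases j
    exacts [by simpa using h 1 1, by simpa using h 0 1, by simpa using h 1 0, by simpa using h 0 0]
  have : u • diagLattice (p : ℚ_[p]) padic_p_ne_zero = diagLattice (p : ℚ_[p]) padic_p_ne_zero :=
    smul_lattice_eq_of (key _ hu.1) (key _ hinv)
  rw [vHat, smul_toVertex, this]

theorem unitP_val :
    ((unitP a b p : (QAlg a b)ˣ) : QAlg a b) = algebraMap ℚ (QAlg a b) (p : ℚ) := rfl

theorem unitP_val_eq_natCast : ((unitP a b p : (QAlg a b)ˣ) : QAlg a b) = (p : QAlg a b) := by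
  rw [unitP_val, map_natCast]

theorem unitP_comm (x : (QAlg a b)ˣ) : unitP a b p * x = x * unitP a b p :=
  Units.ext (Algebra.commutes (p : ℚ) (x : QAlg a b))

theorem toGL_unitP_smul (f : Splitting a b p) (v : Vertex p) : f.toGL (unitP a b p) • v = v :=
  toGL_algebraMap_smul f unitP_val v

theorem nrd_unitP : nrd ((unitP a b p : (QAlg a b)ˣ) : QAlg a b) = (p : ℚ) ^ 2 := by
  rw [unitP_val, nrd_algebraMap]

theorem nrd_inv (u : (QAlg a b)ˣ) :
    nrd ((u⁻¹ : (QAlg a b)ˣ) : QAlg a b) = (nrd (u : QAlg a b))⁻¹ := by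
  refine eq_inv_of_mul_eq_one_left ?_
  rw [← nrd_mul, Units.inv_mul, nrd_one]

variable {f : Splitting a b p} {R R' : Subring (QAlg a b)}

theorem det_toGL (ha : a ≠ 0) (hb : b ≠ 0) (f : Splitting a b p) (u : (QAlg a b)ˣ) :
    (f.toGL u).1.det = ((nrd (u : QAlg a b) : ℚ) : ℚ_[p]) :=
  det_toHom ha hb f u

theorem normOneUnits_mono (h : R ≤ R') : normOneUnits R ≤ normOneUnits R' :=
  fun _ hu => ⟨h hu.1, h hu.2.1, hu.2.2⟩

/-- An order that is maximal at `p` is cut out, in `R ⊗ ℤ[1/p]`, by the distance by which an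
element moves `v_*`. This is how the membership tests see the tree. -/
theorem mem_order_iff_depth_le (ha : a ≠ 0) (hb : b ≠ 0) {N : ℕ} (hN : ¬ p ∣ N) (hR : IsOrder R)
    (hf : (localCompletion f R : Set (Matrix (Fin 2) (Fin 2) ℚ_[p])) = localEichler p N)
    {u : (QAlg a b)ˣ} (hu : (u : QAlg a b) ∈ invertP p R) {m : ℕ}
    (hm : nrd (u : QAlg a b) = (p : ℚ) ^ m) :
    (u : QAlg a b) ∈ R ↔ depth (f.toGL u • vStar p) ≤ m := by
  rw [← entryNorm_le_one_iff_depth_le (g := f.toGL u) (m := m) (by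
    rw [det_toGL ha hb, hm]
    push_cast
    rw [norm_pow, Padic.norm_p, inv_pow])]
  constructor
  · intro h
    have h1 : f.toHom (u : QAlg a b) ∈ (localCompletion f R : Set _) := mem_localCompletion h
    rw [hf] at h1
    exact entryNorm_le_one_of_mem_localEichler h1
  · intro h
    refine mem_of_mem_invertP (f := f) hR hu ?_
    rw [← SetLike.mem_coe, hf]
    exact mem_localEichler_of_not_dvd hN h

/-- Units of norm one of an order of level divisible by `p` act through `Γ₀^loc(p)`. -/
theorem toGL_mem_localGamma0 (ha : a ≠ 0) (hb : b ≠ 0) {N : ℕ}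
    (hf : (localCompletion f R : Set (Matrix (Fin 2) (Fin 2) ℚ_[p])) = localEichler p (p * N))
    {u : (QAlg a b)ˣ} (hu : u ∈ normOneUnits R) : (f.toGL u).1 ∈ localGamma0 p := by
  have h1 : f.toHom (u : QAlg a b) ∈ (localCompletion f R : Set _) := mem_localCompletion hu.1
  rw [hf] at h1
  refine ⟨⟨h1.1, h1.2.trans ?_⟩, by rw [det_toGL ha hb, hu.2.2, Rat.cast_one]⟩
  push_cast
  rw [norm_mul]
  exact mul_le_of_le_one_right (norm_nonneg _) (padic_norm_natCast_le_one N)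

variable {G : Subgroup (QAlg a b)ˣ} {γ : Fin (p + 1) → (QAlg a b)ˣ} {ω : (QAlg a b)ˣ}

theorem nrd_of_isAtkinLehner (ha : a ≠ 0) (hb : b ≠ 0) (hω : IsAtkinLehner f R' ω) :
    nrd (ω : QAlg a b) = p := by
  obtain ⟨u, hu, h⟩ := hω.local_form
  have h1 := det_toHom ha hb f (ω : QAlg a b)
  rw [h, Matrix.det_mul, hu.2] at h1
  have h2 : ((p : ℚ) : ℚ_[p]) = ((nrd (ω : QAlg a b) : ℚ) : ℚ_[p]) := by
    rw [← h1]
    simp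
  exact (Rat.cast_injective h2).symm

theorem IsAtkinLehner.exists_swap (hω : IsAtkinLehner f R' ω) :
    ∃ u : GL (Fin 2) ℚ_[p], u.1 ∈ localGamma0 p ∧ f.toGL ω = u * swapGL p := by
  obtain ⟨u, hu, h⟩ := hω.local_form
  have hval : (f.toGL ω * (swapGL p)⁻¹).1 = u := by
    rw [Units.val_mul, toGL_val, h]
    change u * (swapGL p).1 * ((swapGL p)⁻¹).1 = u
    rw [mul_assoc, ← Units.val_mul, mul_inv_cancel, Units.val_one, mul_one]
  exact ⟨f.toGL ω * (swapGL p)⁻¹, hval ▸ hu, by rw [inv_mul_cancel_right]⟩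

theorem IsAtkinLehner.smul_vStar (hω : IsAtkinLehner f R' ω) : f.toGL ω • vStar p = vHat p := by
  obtain ⟨u, hu, h⟩ := hω.exists_swap
  rw [h, mul_smul, swapGL_smul_vStar, smul_vHat_of_mem_localGamma0 hu]

theorem IsAtkinLehner.smul_vHat (hω : IsAtkinLehner f R' ω) : f.toGL ω • vHat p = vStar p := by
  obtain ⟨u, hu, h⟩ := hω.exists_swap
  rw [h, mul_smul, swapGL_smul_vHat, smul_vStar_eq_vStar (isIntegralGL_of_mem_localGamma0 hu)]

theorem IsAtkinLehner.inv_mem_invertP (ha : a ≠ 0) (hb : b ≠ 0) (hω : IsAtkinLehner f R' ω)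
    (hR : IsOrder R) (hle : R' ≤ R) : ((ω⁻¹ : (QAlg a b)ˣ) : QAlg a b) ∈ invertP p R := by
  refine ⟨1, ?_⟩
  have h : (p : QAlg a b) ^ 1 * ((ω⁻¹ : (QAlg a b)ˣ) : QAlg a b) = star (ω : QAlg a b) := by
    rw [pow_one, (Nat.cast_commute p _).eq, eq_comm, Units.eq_inv_mul_iff_mul_eq, mul_star_eq_nrd,
      nrd_of_isAtkinLehner ha hb hω, map_natCast]
  rw [h]
  exact star_mem_of_isOrder hR (hle hω.mem)

theorem IsUpsilon.inv_smul_vHat (hγ : IsUpsilon f G (normOneUnits R') γ) (i : Fin (p + 1)) :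
    (f.toGL (γ i))⁻¹ • vHat p = lineRep i • vHat p := by
  by_cases hi : i = 0
  · rw [hi, hγ.zero, lineRep_zero, map_one, inv_one]
  · obtain ⟨u, hu, h⟩ := hγ.local_form i hi
    have hval : (f.toGL (γ i) * lineRep i).1 = u := by
      rw [Units.val_mul, toGL_val, h, ← lineRep_inv_val hi, mul_assoc, ← Units.val_mul,
        inv_mul_cancel, Units.val_one, mul_one]
    have hfix := smul_vHat_of_mem_localGamma0 (u := f.toGL (γ i) * lineRep i) (hval ▸ hu)
    rw [inv_smul_eq_iff, ← mul_smul, hfix]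

theorem tildeGamma_zero : tildeGamma γ ω 0 = 1 := if_pos rfl

theorem tildeGamma_of_ne {i : Fin (p + 1)} (hi : i ≠ 0) :
    tildeGamma γ ω i = (unitP a b p)⁻¹ * ω * γ i * ω := if_neg hi

theorem toGL_tildeGamma_smul {i : Fin (p + 1)} (hi : i ≠ 0) (v : Vertex p) :
    f.toGL (tildeGamma γ ω i) • v = f.toGL ω • f.toGL (γ i) • f.toGL ω • v := by
  rw [tildeGamma_of_ne hi, map_mul, map_mul, map_mul, mul_smul, mul_smul, mul_smul, map_inv,
    inv_smul_eq_iff, toGL_unitP_smul]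

/-- The representatives `γ_i` and the element `ω_p`, which exchanges `v_*` and `v̂_*`, provide the
local input for the radial system. -/
theorem isLocallySimplyTransitive (ha : a ≠ 0) (hb : b ≠ 0) {N : ℕ} (hN : ¬ p ∣ N)
    (hR : IsOrder R)
    (hf : (localCompletion f R : Set (Matrix (Fin 2) (Fin 2) ℚ_[p])) = localEichler p N)
    (hle : R' ≤ R) (hγ : IsUpsilon f (normOneUnits R) (normOneUnits R') γ)
    (hω : IsAtkinLehner f R' ω) :
    IsLocallySimplyTransitive f (normOneUnits (invertP p R)) γ (tildeGamma γ ω) := by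
  have hfix : ∀ i, f.toGL (γ i) • vStar p = vStar p := by
    intro i
    have h := (mem_order_iff_depth_le (f := f) (m := 0) ha hb hN hR hf
      (le_invertP (hγ.mem i).1) (by rw [(hγ.mem i).2.2, pow_zero])).1 (hγ.mem i).1
    exact eq_vStar_of_depth_eq_zero (Nat.le_zero.1 h)
  have hnb : ∀ w : Vertex p, Neighbor (vStar p) w → ∃! i, (f.toGL (γ i))⁻¹ • vHat p = w := by
    intro w hw
    obtain ⟨i, rfl⟩ := exists_eq_lineRep_smul_vHat hw
    refine ⟨i, hγ.inv_smul_vHat i, fun j hj => ?_⟩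
    simp only [hγ.inv_smul_vHat] at hj
    exact lineRep_smul_vHat_injective hj
  refine ⟨fun i => normOneUnits_mono le_invertP (hγ.mem i), fun i => ?_, hγ.zero, tildeGamma_zero,
    fun g hg v => even_depth_smul_iff (by rw [det_toGL ha hb, hg.2.2, Rat.cast_one]) v, hfix,
    fun i => ?_, hnb, fun w hw => ?_⟩
  · by_cases hi : i = 0
    · rw [hi, tildeGamma_zero]
      exact Subgroup.one_mem _
    refine mem_normOneUnits_invertP hR ⟨1, ?_⟩ ?_
    · rw [pow_one, ← unitP_val_eq_natCast, ← Units.val_mul, tildeGamma_of_ne hi, mul_assoc,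
        mul_assoc, mul_inv_cancel_left, Units.val_mul, Units.val_mul]
      exact R.mul_mem (hle hω.mem) (R.mul_mem (hγ.mem i).1 (hle hω.mem))
    · have hp : (p : ℚ) ≠ 0 := Nat.cast_ne_zero.2 (Fact.out : p.Prime).ne_zero
      rw [tildeGamma_of_ne hi, Units.val_mul, Units.val_mul, Units.val_mul, nrd_mul, nrd_mul,
        nrd_mul, nrd_inv, nrd_unitP, nrd_of_isAtkinLehner ha hb hω, (hγ.mem i).2.2]
      field_simp
  · by_cases hi : i = 0
    · rw [hi, tildeGamma_zero, map_one, one_smul]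
    · rw [toGL_tildeGamma_smul hi, hω.smul_vHat, hfix, hω.smul_vStar]
  · have hw' := hw.smul (f.toGL ω)
    rw [hω.smul_vHat] at hw'
    have key : ∀ i, (f.toGL (tildeGamma γ ω i))⁻¹ • vStar p = w ↔
        (f.toGL (γ i))⁻¹ • vHat p = f.toGL ω • w := by
      intro i
      rw [inv_smul_eq_iff, inv_smul_eq_iff]
      by_cases hi : i = 0
      · rw [hi, tildeGamma_zero, hγ.zero, map_one, one_smul, one_smul, ← hω.smul_vStar,
          smul_left_cancel_iff]
      · rw [toGL_tildeGamma_smul hi, ← hω.smul_vHat, smul_left_cancel_iff]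
    simp only [key]
    exact hnb _ hw'

end EichlerData

/-! ### Searching and scaling programs -/

section Programs

variable {A τ α : Type} [Ring A] {T : τ → Set A}

/-- Looks for the first `k` in the list such that the contents of register `0`, multiplied by
`c k`, pass the test `i`; then multiplies register `0` by `c k`, register `1` by `r k` on
the right, and register `2` by `l k` on the left. -/
def searchProg (i : τ) (c l r : α → A) : List α → Prog A τ
  | [] => .const 4 0
  | k :: ks =>
    .seq (.const 4 (c k)) (.seq (.mul 3 0 4) (.ite i 3
      (.seq (.copy 0 3) (.seq (.const 4 (r k)) (.seq (.mul 1 1 4)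
        (.seq (.const 4 (l k)) (.mul 2 4 2)))))
      (searchProg i c l r ks)))

theorem exec_searchProg (i : τ) (c l r : α → A) (ks : List α) (s : ℕ → A)
    (h : ∃ k ∈ ks, s 0 * c k ∈ T i) :
    ∃ k ∈ ks, s 0 * c k ∈ T i ∧ ∃ (t : ℕ) (s' : ℕ → A), Exec T (searchProg i c l r ks) s t s' ∧
      s' 0 = s 0 * c k ∧ s' 1 = s 1 * r k ∧ s' 2 = l k * s 2 ∧ t ≤ 3 * ks.length + 5 := by
  induction ks generalizing s with
  | nil => simp at h
  | cons k ks ih =>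
    by_cases hk : s 0 * c k ∈ T i
    · refine ⟨k, by simp, hk, _, _, .seq (.const _ _ _) (.seq (.mul _ _ _ _) (.ite_pos ?_
        (.seq (.copy _ _ _) (.seq (.const _ _ _) (.seq (.mul _ _ _ _)
          (.seq (.const _ _ _) (.mul _ _ _ _))))))), ?_, ?_, ?_, ?_⟩
      · simpa using hk
      · simp
      · simp
      · simp
      · rw [List.length_cons]
        omega
    · have h' : ∃ k ∈ ks, s 0 * c k ∈ T i := by
        obtain ⟨k', hk', hm⟩ := h
        rcases List.mem_cons.1 hk' with rfl | hk'
        · exact absurd hm hk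
        · exact ⟨k', hk', hm⟩
      obtain ⟨k', hk', hm, t, s', hE, h0, h1, h2, ht⟩ :=
        ih (Function.update (Function.update s 4 (c k)) 3 (s 0 * c k)) (by simpa using h')
      refine ⟨k', by simp [hk'], by simpa using hm, _, s', .seq (.const _ _ _)
        (.seq (.mul _ _ _ _) (.ite_neg (t := t) ?_ ?_)), ?_, ?_, ?_, ?_⟩
      · simpa using hk
      · simpa using hE
      · simpa using h0
      · simpa using h1
      · simpa using h2
      · rw [List.length_cons]
        omega

/-- Multiplies register `0` by `c` until it passes the test `i`. -/
def scaleProg (i : τ) (c : A) : Prog A τ := .untilMem i 0 (.seq (.const 4 c) (.mul 0 0 4))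

theorem exec_scaleProg (i : τ) (c : A) (n : ℕ) (s : ℕ → A) (hn : s 0 * c ^ n ∈ T i)
    (h : ∀ m < n, s 0 * c ^ m ∉ T i) :
    ∃ s', Exec T (scaleProg i c) s (3 * n + 1) s' ∧ s' 0 = s 0 * c ^ n ∧ s' 1 = s 1 ∧
      s' 2 = s 2 := by
  induction n generalizing s with
  | zero => exact ⟨s, .until_done (by simpa using hn), by simp, rfl, rfl⟩
  | succ n ih =>
    obtain ⟨s', hE, h0, h1, h2⟩ := ih
      (Function.update (Function.update s 4 c) 0 (s 0 * c))
      (by simpa [mul_assoc, ← pow_succ'] using hn)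
      (fun m hm => by simpa [mul_assoc, ← pow_succ'] using h (m + 1) (by omega))
    refine ⟨s', ?_, by simpa [mul_assoc, ← pow_succ'] using h0, by simpa using h1,
      by simpa using h2⟩
    have hstep : Exec T (.seq (.const 4 c) (.mul 0 0 4)) s 2
        (Function.update (Function.update s 4 c) 0 (s 0 * c)) := by
      have := Exec.seq (T := T) (.const 4 c s) (.mul 0 0 4 (Function.update s 4 c))
      simpa using this
    have := Exec.until_step (i := i) (x := 0) (by simpa using h 0 (by omega)) hstep hE
    rw [show 3 * (n + 1) + 1 = 2 + 1 + (3 * n + 1) by ring]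
    exact this

end Programs

/-! ### Following a path in the tree -/

section Path

variable {a b : ℚ} {p : ℕ} [Fact p.Prime]

theorem exists_closer_neighbor {v u : Vertex p} {k : ℕ} (h : (bruhatTits p).dist v u = k + 1) :
    ∃ w, Neighbor v w ∧ (bruhatTits p).dist w u ≤ k := by
  obtain ⟨W, hW⟩ := bruhatTits_connected.exists_walk_length_eq_dist v u
  rw [h] at hW
  cases W with
  | nil => simp at hW
  | cons hadj W' =>
    rw [SimpleGraph.Walk.length_cons] at hW
    exact ⟨_, bruhatTits_adj.1 hadj, (SimpleGraph.dist_le W').trans (by omega)⟩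

variable {f : Splitting a b p} {Γ : Subgroup (QAlg a b)ˣ} {γ γt : Fin (p + 1) → (QAlg a b)ˣ}

namespace IsLocallySimplyTransitive

theorem exists_step_closer (H : IsLocallySimplyTransitive f Γ γ γt) {v u : Vertex p} {k : ℕ}
    (h : (bruhatTits p).dist v u = k + 1) :
    ∃ i, (bruhatTits p).dist
      ((f.toGL (stepFamily γ γt (depth v + 1) i * radialVertex f γ γt v))⁻¹ •
        baseVertex p (depth v + 1)) u ≤ k := by
  obtain ⟨w, hw, hd⟩ := exists_closer_neighbor h
  obtain ⟨i, hi, -⟩ := H.existsUnique_step hw (H.radialVertex_spec v).2.1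
  have hpar := even_depth_neighbor hw
  have hs : stepFamily γ γt (depth w) = stepFamily γ γt (depth v + 1) := by
    simp only [stepFamily, hpar, Nat.even_add_one]
  have hb : baseVertex p (depth w) = baseVertex p (depth v + 1) := by
    simp only [baseVertex, hpar, Nat.even_add_one]
  refine ⟨i, ?_⟩
  simp only [hs, hb] at hi
  rw [hi]
  exact hd

/-- If `v` lies on the path from `v_*` to `u`, then a step from `v` that approaches `u` agrees with
the step of the radial system. -/
theorem radialVertex_of_step_closer (H : IsLocallySimplyTransitive f Γ γ γt) {v u : Vertex p}
    {k : ℕ} (h : (bruhatTits p).dist v u = k + 1)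
    (hvu : depth v + (bruhatTits p).dist v u = depth u) {i : Fin (p + 1)}
    (hi : (bruhatTits p).dist
      ((f.toGL (stepFamily γ γt (depth v + 1) i * radialVertex f γ γt v))⁻¹ •
        baseVertex p (depth v + 1)) u ≤ k) :
    ∃ w, stepFamily γ γt (depth v + 1) i * radialVertex f γ γt v = radialVertex f γ γt w ∧
      depth w = depth v + 1 ∧ (bruhatTits p).dist w u = k ∧
      depth w + (bruhatTits p).dist w u = depth u := by
  set g := stepFamily γ γt (depth v + 1) i * radialVertex f γ γt v with hg
  set w := (f.toGL g)⁻¹ • baseVertex p (depth v + 1) with hw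
  have hv2 := (H.radialVertex_spec v).2.1
  have hgv : (f.toGL g)⁻¹ • baseVertex p (depth v) = v := by
    have hfix : (f.toGL (stepFamily γ γt (depth v + 1) i))⁻¹ • baseVertex p (depth v) =
        baseVertex p (depth v) := by
      rw [inv_smul_eq_iff, eq_comm]
      by_cases hv : Even (depth v)
      · rw [baseVertex_even hv, stepFamily_odd (by rwa [Nat.even_add_one, not_not])]
        exact H.smul_vStar i
      · rw [baseVertex_odd hv, stepFamily_even (by rwa [Nat.even_add_one])]
        exact H.smul_vHat i
    rw [hg, map_mul, mul_inv_rev, mul_smul, hfix, hv2]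
  have hnb : Neighbor v w := by
    have h0 : Neighbor (baseVertex p (depth v)) (baseVertex p (depth v + 1)) := by
      by_cases hv : Even (depth v)
      · rw [baseVertex_even hv, baseVertex_odd (by rwa [Nat.even_add_one, not_not])]
        exact neighbor_vStar_vHat
      · rw [baseVertex_odd hv, baseVertex_even (by rwa [Nat.even_add_one])]
        exact neighbor_symm neighbor_vStar_vHat
    have := h0.smul (f.toGL g)⁻¹
    rwa [hgv] at this
  have htri := bruhatTits_connected.dist_triangle (u := u) (v := w) (w := vStar p)
  rw [SimpleGraph.dist_comm (u := u) (v := w)] at htri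
  change depth u ≤ _ + depth w at htri
  have hd : depth w = depth v + 1 := by
    rcases depth_neighbor hnb with h' | h' <;> omega
  refine ⟨w, ?_, hd, by omega, by omega⟩
  obtain ⟨j, hj⟩ := H.radialVertex_eq_step hnb hd
  have hu := H.existsUnique_step hnb hv2
  have hw2 := (H.radialVertex_spec w).2.1
  rw [hj] at hw2
  have hij := hu.unique hw2 (show _ = w by rw [hd])
  rw [hj, hij, hd]

end IsLocallySimplyTransitive

end Path

/-! ### The algorithm -/

section Algorithm

variable {a b : ℚ} {p : ℕ} [Fact p.Prime]

/-- One even step of the descent: multiplication of `x` by `γ_i⁻¹`, for the first `i` such that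
`p ^ n x γ_i⁻¹ ω⁻¹` lies in `R₀(M)`. -/
def evenStepProg (γ : Fin (p + 1) → (QAlg a b)ˣ) (ω : (QAlg a b)ˣ) : Prog (QAlg a b) Bool :=
  searchProg false (fun i => ((γ i)⁻¹ * ω⁻¹ : (QAlg a b)ˣ).val) (fun i => (γ i).val)
    (fun i => ((γ i)⁻¹).val) (List.finRange (p + 1))

/-- One odd step of the descent: multiplication of `x` by `γ̃_j⁻¹`, for the first `j` such that
`p ^ (n - 1) x γ̃_j⁻¹` lies in `R₀(M)`. The factor `ω p⁻¹` turns the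
contents `p ^ n x ω⁻¹` of register `0` into `p ^ (n - 1) x`. -/
def oddStepProg (γ : Fin (p + 1) → (QAlg a b)ˣ) (ω : (QAlg a b)ˣ) : Prog (QAlg a b) Bool :=
  searchProg false (fun j => (ω * (tildeGamma γ ω j)⁻¹ * (unitP a b p)⁻¹ : (QAlg a b)ˣ).val)
    (fun j => (tildeGamma γ ω j).val) (fun j => ((tildeGamma γ ω j)⁻¹).val)
    (List.finRange (p + 1))

/-- Walks from `v_*` to the source of the edge, two steps at a time. -/
def descentProg (γ : Fin (p + 1) → (QAlg a b)ˣ) (ω : (QAlg a b)ˣ) : Prog (QAlg a b) Bool :=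
  .untilMem false 1 (.seq (evenStepProg γ ω) (oddStepProg γ ω))

/-- The last factor of `γ_e`: the coset of `x ∈ Γ₀(M)` in `Γ₀(pM) \ Γ₀(M)`. -/
def cosetProg (γ : Fin (p + 1) → (QAlg a b)ˣ) : Prog (QAlg a b) Bool :=
  searchProg true (fun i => ((γ i)⁻¹).val) (fun i => (γ i).val)
    (fun i => ((γ i)⁻¹).val) (List.finRange (p + 1))

/-- The algorithm that writes `g` as `h γ_e`. Register `1` holds `x` and register `2` holds `y` with
`g = x y`, where `y` is the element `γ_v` of a vertex `v` on the way from `v_*` to `s(e)`;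
at the head of the loop, register `0` holds the product of `x` and the power of `p` that makes it
primitive in `R₀(M)`. -/
def factorProg (γ : Fin (p + 1) → (QAlg a b)ˣ) (ω : (QAlg a b)ˣ) : Prog (QAlg a b) Bool :=
  .seq (.copy 1 0) (.seq (.const 2 1) (.seq (scaleProg false (unitP a b p).val)
    (.seq (descentProg γ ω) (.seq (.copy 0 1) (cosetProg γ)))))

theorem dist_smul_vStar_eq (x y : GL (Fin 2) ℚ_[p]) (w : Vertex p) :
    (bruhatTits p).dist (x • w) (vStar p) =
      (bruhatTits p).dist (y⁻¹ • w) ((x * y)⁻¹ • vStar p) := by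
  rw [← dist_smul_smul (x * y)⁻¹, ← mul_smul]
  congr 2
  group

theorem toGL_unitP_pow_smul (f : Splitting a b p) (n : ℕ) (v : Vertex p) :
    f.toGL (unitP a b p ^ n) • v = v := by
  induction n with
  | zero => rw [pow_zero, map_one, one_smul]
  | succ n ih => rw [pow_succ, map_mul, mul_smul, toGL_unitP_smul, ih]

theorem nrd_unitP_pow (n : ℕ) :
    nrd ((unitP a b p ^ n : (QAlg a b)ˣ) : QAlg a b) = (p : ℚ) ^ (2 * n) := by
  induction n with
  | zero => simpa using nrd_one
  | succ n ih => rw [pow_succ, Units.val_mul, nrd_mul, ih, nrd_unitP, ← pow_add, mul_add_one]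

theorem unitP_pow_mem (R : Subring (QAlg a b)) (n : ℕ) :
    ((unitP a b p ^ n : (QAlg a b)ˣ) : QAlg a b) ∈ R := by
  rw [Units.val_pow_eq_pow_val, unitP_val_eq_natCast]
  exact R.pow_mem (natCast_mem R p) n

variable {f : Splitting a b p} {R R' : Subring (QAlg a b)}
  {γ : Fin (p + 1) → (QAlg a b)ˣ} {ω : (QAlg a b)ˣ}

theorem mul_unitP_pow_mem_iff (ha : a ≠ 0) (hb : b ≠ 0) {N : ℕ} (hN : ¬ p ∣ N) (hR : IsOrder R)
    (hf : (localCompletion f R : Set (Matrix (Fin 2) (Fin 2) ℚ_[p])) = localEichler p N)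
    {x : (QAlg a b)ˣ} (hx : x ∈ normOneUnits (invertP p R)) (n : ℕ) :
    ((x * unitP a b p ^ n : (QAlg a b)ˣ) : QAlg a b) ∈ R ↔
      depth (f.toGL x • vStar p) ≤ 2 * n := by
  rw [mem_order_iff_depth_le (f := f) (m := 2 * n) ha hb hN hR hf, map_mul, mul_smul,
    toGL_unitP_pow_smul]
  · rw [Units.val_mul]
    exact (invertP p R).mul_mem hx.1 (unitP_pow_mem _ n)
  · rw [Units.val_mul, nrd_mul, hx.2.2, one_mul, nrd_unitP_pow]

theorem evenStep_mem_iff (ha : a ≠ 0) (hb : b ≠ 0) {N : ℕ} (hN : ¬ p ∣ N) (hR : IsOrder R)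
    (hf : (localCompletion f R : Set (Matrix (Fin 2) (Fin 2) ℚ_[p])) = localEichler p N)
    (hle : R' ≤ R) (hω : IsAtkinLehner f R' ω) {x y δ : (QAlg a b)ˣ}
    (hx : x ∈ normOneUnits (invertP p R)) (hδ : δ ∈ normOneUnits (invertP p R)) (n : ℕ) :
    ((x * unitP a b p ^ (n + 1) : (QAlg a b)ˣ) : QAlg a b) * ((δ⁻¹ * ω⁻¹ : (QAlg a b)ˣ) : QAlg a b)
        ∈ R ↔
      (bruhatTits p).dist ((f.toGL (δ * y))⁻¹ • vHat p) ((f.toGL (x * y))⁻¹ • vStar p) ≤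
        2 * n + 1 := by
  have hp : (p : ℚ) ≠ 0 := Nat.cast_ne_zero.2 (Fact.out : p.Prime).ne_zero
  have hω' : (f.toGL ω)⁻¹ • vStar p = vHat p := by rw [← hω.smul_vHat, inv_smul_smul]
  rw [← Units.val_mul, mem_order_iff_depth_le (f := f) (m := 2 * n + 1) ha hb hN hR hf]
  · simp only [map_mul, map_inv, mul_smul, mul_inv_rev]
    rw [hω', toGL_unitP_pow_smul, depth, dist_smul_vStar_eq _ (f.toGL y), mul_inv_rev,
      mul_smul]
  · simp only [Units.val_mul]
    exact (invertP p R).mul_mem ((invertP p R).mul_mem hx.1 (unitP_pow_mem _ _))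
      ((invertP p R).mul_mem hδ.2.1 (hω.inv_mem_invertP ha hb hR hle))
  · simp only [Units.val_mul, nrd_mul, nrd_unitP_pow, hx.2.2, nrd_inv, hδ.2.2,
      nrd_of_isAtkinLehner ha hb hω]
    field_simp
    ring

/-- The descent: starting from `g = x γ_v` with `v` on the path from `v_*` to `u = g⁻¹ v_*`, the
loop ends with `g = x' γ_u`, after a number of steps proportional to the distance from `v`
to `u`. -/
theorem exec_descentProg (ha : a ≠ 0) (hb : b ≠ 0) {N : ℕ} (hN : ¬ p ∣ N) (hR : IsOrder R)
    (hf : (localCompletion f R : Set (Matrix (Fin 2) (Fin 2) ℚ_[p])) = localEichler p N)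
    (hle : R' ≤ R) (hω : IsAtkinLehner f R' ω)
    (H : IsLocallySimplyTransitive f (normOneUnits (invertP p R)) γ (tildeGamma γ ω))
    (n : ℕ) {v u : Vertex p} (hv : Even (depth v)) (hd : (bruhatTits p).dist v u = 2 * n)
    (hvu : depth v + (bruhatTits p).dist v u = depth u)
    {x y : (QAlg a b)ˣ} (hx : x ∈ normOneUnits (invertP p R))
    (hy : y = radialVertex f γ (tildeGamma γ ω) v) (hu : u = (f.toGL (x * y))⁻¹ • vStar p)
    (s : ℕ → QAlg a b) (h0 : s 0 = (x * unitP a b p ^ n : (QAlg a b)ˣ).val) (h1 : s 1 = x.val)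
    (h2 : s 2 = y.val) :
    ∃ x' ∈ normOneUnits (invertP p R), (x' : QAlg a b) ∈ R ∧
      x' * radialVertex f γ (tildeGamma γ ω) u = x * y ∧
      ∃ (t : ℕ) (s' : ℕ → QAlg a b), Exec (orderTest R R') (descentProg γ ω) s t s' ∧
        s' 1 = x'.val ∧ s' 2 = (radialVertex f γ (tildeGamma γ ω) u).val ∧
        n ≤ t ∧ t ≤ (6 * p + 17) * n + 1 := by
  have hyv : (f.toGL y)⁻¹ • vStar p = v := by
    have := (H.radialVertex_spec v).2.1
    rwa [baseVertex_even hv, ← hy] at this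
  have htest : x.val ∈ R ↔ (bruhatTits p).dist v u ≤ 0 := by
    have := mul_unitP_pow_mem_iff ha hb hN hR hf hx 0
    rw [pow_zero, mul_one] at this
    rw [this, depth, dist_smul_vStar_eq _ (f.toGL y), hyv, ← map_mul, ← hu]
  induction n generalizing v x y s with
  | zero =>
    have hmem : x.val ∈ R := htest.2 (by omega)
    have hvu' : v = u := (bruhatTits_connected.dist_eq_zero_iff).1 (by omega)
    subst hvu'
    exact ⟨x, hx, hmem, by rw [hy], 1, s, .until_done (h1 ▸ hmem), h1, hy ▸ h2, by omega, by omega⟩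
  | succ n ih =>
    have hnmem : s 1 ∉ orderTest R R' false := by
      rw [h1]
      intro h
      have := htest.1 h
      omega
    -- the even step
    have heven : ∀ i, s 0 * ((γ i)⁻¹ * ω⁻¹ : (QAlg a b)ˣ).val ∈ orderTest R R' false ↔
        (bruhatTits p).dist ((f.toGL (stepFamily γ (tildeGamma γ ω) (depth v + 1) i *
          radialVertex f γ (tildeGamma γ ω) v))⁻¹ • baseVertex p (depth v + 1)) u ≤ 2 * n + 1 := by
      intro i
      have hodd : ¬ Even (depth v + 1) := by rwa [Nat.even_add_one, not_not]
      rw [h0, stepFamily_odd hodd, baseVertex_odd hodd, hu, ← hy]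
      exact evenStep_mem_iff ha hb hN hR hf hle hω hx (H.mem i) n
    obtain ⟨i₀, hi₀⟩ := H.exists_step_closer (v := v) (u := u) (k := 2 * n + 1) (by omega)
    obtain ⟨i, -, hi, t₁, s₁, hE₁, h10, h11, h12, ht₁⟩ :=
      exec_searchProg (T := orderTest R R') false (fun i => ((γ i)⁻¹ * ω⁻¹ : (QAlg a b)ˣ).val)
        (fun i => (γ i).val) (fun i => ((γ i)⁻¹).val) (List.finRange (p + 1)) s
        ⟨i₀, List.mem_finRange _, (heven i₀).2 hi₀⟩
    obtain ⟨w, hw, hdw, hwu, hwu'⟩ :=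
      H.radialVertex_of_step_closer (by omega) hvu ((heven i).1 hi)
    have hwodd : ¬ Even (depth w) := by rwa [hdw, Nat.even_add_one, not_not]
    rw [stepFamily_odd (hdw ▸ hwodd), ← hy] at hw
    -- the odd step
    have hxj : ∀ j, x * (γ i)⁻¹ * (tildeGamma γ ω j)⁻¹ ∈ normOneUnits (invertP p R) := fun j =>
      Subgroup.mul_mem _ (Subgroup.mul_mem _ hx (Subgroup.inv_mem _ (H.mem i)))
        (Subgroup.inv_mem _ (H.mem_tilde j))
    have hreg : ∀ j, s₁ 0 * (ω * (tildeGamma γ ω j)⁻¹ * (unitP a b p)⁻¹ : (QAlg a b)ˣ).val =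
        (x * (γ i)⁻¹ * (tildeGamma γ ω j)⁻¹ * unitP a b p ^ n : (QAlg a b)ˣ).val := by
      intro j
      rw [h10, h0, ← Units.val_mul, ← Units.val_mul]
      congr 1
      have hc : ∀ z : (QAlg a b)ˣ, Commute (unitP a b p) z := fun z => unitP_comm z
      simp only [mul_assoc, inv_mul_cancel_left]
      rw [((hc _).pow_left (n + 1)).eq, pow_succ']
      simp only [mul_assoc, inv_mul_cancel_left]
    have hodd : ∀ j, s₁ 0 * (ω * (tildeGamma γ ω j)⁻¹ * (unitP a b p)⁻¹ : (QAlg a b)ˣ).val ∈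
        orderTest R R' false ↔
        (bruhatTits p).dist ((f.toGL (stepFamily γ (tildeGamma γ ω) (depth w + 1) j *
          radialVertex f γ (tildeGamma γ ω) w))⁻¹ • baseVertex p (depth w + 1)) u ≤ 2 * n := by
      intro j
      have hev : Even (depth w + 1) := Nat.even_add_one.2 hwodd
      rw [hreg, stepFamily_even hev, baseVertex_even hev, ← hw]
      refine (mul_unitP_pow_mem_iff ha hb hN hR hf (hxj j) n).trans ?_
      rw [depth, dist_smul_vStar_eq _ (f.toGL (tildeGamma γ ω j * (γ i * y))), ← map_mul, hu]
      have e : x * (γ i)⁻¹ * (tildeGamma γ ω j)⁻¹ * (tildeGamma γ ω j * (γ i * y)) = x * y := by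
        group
      rw [e]
    obtain ⟨j₀, hj₀⟩ := H.exists_step_closer (v := w) (u := u) (k := 2 * n) (by omega)
    obtain ⟨j, -, hj, t₂, s₂, hE₂, h20, h21, h22, ht₂⟩ :=
      exec_searchProg (T := orderTest R R') false
        (fun j => (ω * (tildeGamma γ ω j)⁻¹ * (unitP a b p)⁻¹ : (QAlg a b)ˣ).val)
        (fun j => (tildeGamma γ ω j).val) (fun j => ((tildeGamma γ ω j)⁻¹).val)
        (List.finRange (p + 1)) s₁ ⟨j₀, List.mem_finRange _, (hodd j₀).2 hj₀⟩
    obtain ⟨v', hv', hdv', hv'u, hv'u'⟩ :=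
      H.radialVertex_of_step_closer (by omega) hwu' ((hodd j).1 hj)
    have hev' : Even (depth v') := by rwa [hdv', Nat.even_add_one]
    rw [stepFamily_even (hdv' ▸ hev'), ← hw] at hv'
    have hprod : x * (γ i)⁻¹ * (tildeGamma γ ω j)⁻¹ * (tildeGamma γ ω j * (γ i * y)) = x * y := by
      group
    have hyv' := (H.radialVertex_spec v').2.1
    rw [baseVertex_even hev', ← hv'] at hyv'
    obtain ⟨x', hx', hx'R, hx'g, t₃, s₃, hE₃, h31, h32, ht₃, ht₃'⟩ :=
      ih hev' hv'u hv'u' (hxj j) hv' (by rw [hprod, hu]) s₂ (by rw [h20, hreg])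
        (by rw [h21, h11, h1, Units.val_mul, Units.val_mul])
        (by rw [h22, h12, h2, Units.val_mul, Units.val_mul]) hyv' (by
          have := mul_unitP_pow_mem_iff ha hb hN hR hf (hxj j) 0
          rw [pow_zero, mul_one] at this
          rw [this, depth, dist_smul_vStar_eq _ (f.toGL (tildeGamma γ ω j * (γ i * y))), hyv',
            ← map_mul, hprod, ← hu])
    refine ⟨x', hx', hx'R, hx'g.trans hprod, _, s₃, .until_step hnmem (.seq hE₁ hE₂) hE₃, h31, h32,
      by omega, ?_⟩
    rw [List.length_finRange] at ht₁ ht₂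
    have : (6 * p + 17) * (n + 1) + 1 = (6 * p + 17) * n + 1 + (6 * p + 17) := by ring
    omega

/-- Correctness and running time of the algorithm. -/
theorem exec_factorProg (ha : a ≠ 0) (hb : b ≠ 0) {N : ℕ} (hN : ¬ p ∣ N) (hR : IsOrder R)
    (hf : (localCompletion f R : Set (Matrix (Fin 2) (Fin 2) ℚ_[p])) = localEichler p N)
    (hR' : IsOrder R')
    (hf' : (localCompletion f R' : Set (Matrix (Fin 2) (Fin 2) ℚ_[p])) = localEichler p (p * N))
    (hle : R' ≤ R) (hγ : IsUpsilon f (normOneUnits R) (normOneUnits R') γ)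
    (hω : IsAtkinLehner f R' ω) {g : (QAlg a b)ˣ} (hg : g ∈ normOneUnits (invertP p R)) :
    ∃ e : EvenEdge p, e.1 = (f.toGL g)⁻¹ • eStar p ∧
      ∃ h ∈ normOneUnits R', g = h * radialEdge f γ (tildeGamma γ ω) e ∧
        ∃ (t : ℕ) (s : ℕ → QAlg a b),
          Exec (orderTest R R') (factorProg γ ω) (inputState (g : QAlg a b)) t s ∧
          s 1 = (h : QAlg a b) ∧ s 2 = (radialEdge f γ (tildeGamma γ ω) e : QAlg a b) ∧
          edgeDist e.1 ≤ (6 * p + 26) * t ∧ t ≤ (6 * p + 26) * (edgeDist e.1 + 1) := by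
  have H := isLocallySimplyTransitive ha hb hN hR hf hle hγ hω
  set u := (f.toGL g)⁻¹ • vStar p with hu
  let e : EvenEdge p := ⟨(f.toGL g)⁻¹ • eStar p, H.mem_even_edge hg⟩
  have hue : Even (depth u) := H.mem_even_edge hg
  obtain ⟨n, hn⟩ := hue.two_dvd
  have hdist : (bruhatTits p).dist (vStar p) u = 2 * n := by rw [SimpleGraph.dist_comm, ← hn, depth]
  have hedge : edgeDist e.1 = 2 * n := hdist
  have hgd : depth (f.toGL g • vStar p) = 2 * n := by rw [← depth_inv_smul, ← hn]
  -- multiplication by powers of `p` until the product is primitive in `R₀(M)`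
  let s₀ : ℕ → QAlg a b := Function.update (Function.update (inputState (g : QAlg a b)) 1 g) 2 1
  have hs₀ : ∀ m, s₀ 0 * (unitP a b p).val ^ m ∈ orderTest R R' false ↔ n ≤ m := by
    intro m
    have h1 : s₀ 0 * (unitP a b p).val ^ m = (g * unitP a b p ^ m : (QAlg a b)ˣ).val := by
      simp [s₀, inputState]
    rw [h1]
    refine (mul_unitP_pow_mem_iff ha hb hN hR hf hg m).trans ?_
    rw [hgd]
    omega
  obtain ⟨s₁, hE₁, h10, h11, h12⟩ := exec_scaleProg (T := orderTest R R') false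
    (unitP a b p).val n s₀ ((hs₀ n).2 le_rfl) fun m hm h => by
      have := (hs₀ m).1 h
      omega
  obtain ⟨x, hx, hxR, hxg, t₂, s₂, hE₂, h21, h22, ht₂, ht₂'⟩ :=
    exec_descentProg ha hb hN hR hf hle hω H n (v := vStar p) (u := u) (x := g) (y := 1)
      (by rw [depth_vStar]; exact Even.zero) hdist (by rw [depth_vStar, hdist, hn, zero_add]) hg
      radialVertex_vStar.symm (by rw [mul_one]) s₁ (by rw [h10]; simp [s₀, inputState])
      (by rw [h11]; simp [s₀]) (by rw [h12]; simp [s₀])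
  rw [mul_one] at hxg
  -- the coset of the remaining factor
  have hx0 : x ∈ normOneUnits R :=
    mem_normOneUnits_of_star (fun _ => star_mem_of_isOrder hR) hxR hx.2.2
  obtain ⟨k₀, hk₀, -⟩ := hγ.representatives x hx0
  let s₃ : ℕ → QAlg a b := Function.update s₂ 0 (s₂ 1)
  have hreg : ∀ k, s₃ 0 * ((γ k)⁻¹).val = (x * (γ k)⁻¹ : (QAlg a b)ˣ).val := fun k => by
    simp [s₃, h21]
  obtain ⟨k, -, hk, t₄, s₄, hE₄, -, h41, h42, ht₄⟩ :=
    exec_searchProg (T := orderTest R R') true (fun i => ((γ i)⁻¹).val) (fun i => (γ i).val)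
      (fun i => ((γ i)⁻¹).val) (List.finRange (p + 1)) s₃
      ⟨k₀, List.mem_finRange _, by rw [hreg]; exact hk₀.1⟩
  rw [hreg] at hk
  have hh : x * (γ k)⁻¹ ∈ normOneUnits R' := by
    refine mem_normOneUnits_of_star (fun _ => star_mem_of_isOrder hR') hk ?_
    rw [Units.val_mul, nrd_mul, nrd_inv, hx.2.2, (hγ.mem k).2.2, inv_one, one_mul]
  have hgh : g = x * (γ k)⁻¹ * (γ k * radialVertex f γ (tildeGamma γ ω) u) := by
    rw [← hxg]
    group
  have hE : radialEdge f γ (tildeGamma γ ω) e = γ k * radialVertex f γ (tildeGamma γ ω) u := by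
    refine H.radialEdge_eq_of_src e ?_
    change _ = (f.toGL g)⁻¹ • vHat p
    conv_rhs => rw [hgh, map_mul, mul_inv_rev, mul_smul]
    rw [inv_smul_eq_iff.2
      (smul_vHat_of_mem_localGamma0 (toGL_mem_localGamma0 ha hb hf' hh)).symm]
    rfl
  refine ⟨e, rfl, _, hh, by rw [hE, ← hgh], _, s₄, .seq (.copy _ _ _) (.seq (.const _ _ _)
    (.seq hE₁ (.seq hE₂ (.seq (.copy _ _ _) hE₄)))), ?_, ?_, ?_, ?_⟩
  · rw [h41]
    simp [s₃, h21]
  · rw [h42, hE]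
    simp [s₃, h22]
  · rw [hedge]
    nlinarith
  · rw [hedge]
    rw [List.length_finRange] at ht₄
    nlinarith

end Algorithm

end

theorem mainTheorem4
    (p D M : ℕ) [Fact p.Prime] (hD : 1 < D) (hDeven : Even D.primeFactors.card)
    (hM : 0 < M) (hDM : Nat.Coprime D M) (hpDM : ¬ p ∣ D * M)
    -- the quaternion algebra `B` of discriminant `D`, and the splittings at the primes of `pM`
    (a b : ℚ) (ha : a ≠ 0) (hb : b ≠ 0) (hB : HasDiscriminant a b D)
    (ι : ∀ (ℓ : ℕ) [Fact ℓ.Prime], ℓ ∣ p * M → Splitting a b ℓ)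
    -- the Eichler orders `R₀(pM) ⊆ R₀(M)`
    (R₀M R₀pM : Subring (QAlg a b)) (hR₀M : IsEichlerOrder ι M R₀M)
    (hR₀pM : IsEichlerOrder ι (p * M) R₀pM) (hle : R₀pM ≤ R₀M)
    -- the fixed elements `γ₀, …, γ_p` and `ω_p`
    (γ : Fin (p + 1) → (QAlg a b)ˣ)
    (hγ : IsUpsilon (ι p (Nat.dvd_mul_right p M)) (normOneUnits R₀M) (normOneUnits R₀pM) γ)
    (ω : (QAlg a b)ˣ) (hω : IsAtkinLehner (ι p (Nat.dvd_mul_right p M)) R₀pM ω) :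
    ∃ γE : EvenEdge p → (QAlg a b)ˣ, ∃ γV : Vertex p → (QAlg a b)ˣ,
      -- `γE`, `γV` is the radial system, the only one
      (∀ (γE' : EvenEdge p → (QAlg a b)ˣ) (γV' : Vertex p → (QAlg a b)ˣ),
        IsRadialSystem (ι p (Nat.dvd_mul_right p M)) (normOneUnits (invertP p R₀M))
          γ (tildeGamma γ ω) γE' γV' ↔ γE' = γE ∧ γV' = γV) ∧
      -- the algorithm, with output in registers `1` and `2`
      ∃ (P : Prog (QAlg a b) Bool) (C : ℕ),
        ∀ g ∈ normOneUnits (invertP p R₀M), ∃ e : EvenEdge p,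
          e.1 = ((ι p (Nat.dvd_mul_right p M)).toGL g)⁻¹ • eStar p ∧
          ∃ h ∈ normOneUnits R₀pM, g = h * γE e ∧
            ∃ (t : ℕ) (s : ℕ → QAlg a b),
              Exec (orderTest R₀M R₀pM) P (inputState (g : QAlg a b)) t s ∧
              s 1 = (h : QAlg a b) ∧ s 2 = (γE e : QAlg a b) ∧
              edgeDist e.1 ≤ C * t ∧ t ≤ C * (edgeDist e.1 + 1) := by
  have hpM : ¬ p ∣ M := fun h => hpDM (Dvd.dvd.mul_left h D)
  have hf := hR₀M.local_form p (Nat.dvd_mul_right p M)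
  have hf' := hR₀pM.local_form p (Nat.dvd_mul_right p M)
  have H := isLocallySimplyTransitive ha hb hpM hR₀M.isOrder hf hle hγ hω
  exact ⟨_, _, H.isRadialSystem_iff, factorProg γ ω, 6 * p + 26, fun g hg =>
    exec_factorProg ha hb hpM hR₀M.isOrder hf hR₀pM.isOrder hf' hle hγ hω hg⟩
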